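/- **Theorem 1 (Convergence of Grouped Sequential Training).** *Setting.* Let $F_1,\dots,F_M:\mathbb R^d\to\mathbb R$ ($M\ge 1$) be the losses of $M$ datasets and $F=\frac1M\sum_{m}F_m$. Assume $F\ge F^\star$ for some $F^\star\in\mathbb R$ and $F(\Theta^{(0)})-F^\star\le\Delta$ at the starting point $\Theta^{(0)}$. Assume: - (AS1) each $F_m$ is $L$-smooth (differentiable with $L$-Lipschitz gradient); - (AS2) each dataset $m$ has an unbiased stochastic gradient $g_m(\Theta)$, computed from a random sample of that dataset, with $\mathbb E\|g_m(\Theta)-\nabla F_m(\Theta)\|^2\le\sigma^2$ for all $\Theta$; - (AS3) $\frac1M\sum_m\|\nabla F_m(\Theta)-\nabla F(\Theta)\|^2\le\beta^2\|\nabla F(\Theta)\|^2+\zeta^2$ for all $\Theta$. Let the datasets be partitioned into $K$ nonempty groups $\mathcal G_1,\dots,\mathcal G_K$ of sizes $M_k$, let $M_{\min}=\min_kM_k$, and let $\rho$ satisfy $KM_k\le\rho M$ for all $k$ (one can take $\rho=1$ if the groups have equal size). Put $F^{(k)}=\frac1{M_k}\sum_{m\in\mathcal G_k}F_m$ and $g^{(k)}=\frac1{M_k}\sum_{m\in\mathcal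 G_k}g_m$, the samples of different datasets being independent. Let $$\sigma_g=\Big(\sup_{k,\Theta}\mathbb E\|g^{(k)}(\Theta)-\nabla F^{(k)}(\Theta)\|^2\Big)^{1/2}$$ be the within-group gradient noise, and call $\beta_g,\zeta_g\ge0$ inter-group heterogeneity constants if $$\frac1K\sum_{k=1}^K\|\nabla F^{(k)}(\Theta)-\nabla F(\Theta)\|^2\le\beta_g^2\|\nabla F(\Theta)\|^2+\zeta_g^2\quad\text{for all }\Theta .$$ *Algorithm.* Grouped Sequential Training with step length $\gamma>0$ works in rounds. At the start of each round a uniformly random order of the groups is drawn, independently of everything before. The groups are then visited once each in this order, each visit starting from the parameter at which the previous one ended. On group $k$ it makes $S_k\ge1$ stochastic gradient steps with the gradient $g^{(k)}$, fresh independent samples and step size $\gamma M_k/(MS_k)$. (For equal group sizes and equal $S_k$ this is one common step size.) $\Theta^{(r)}$ is the parameter after $r$ rounds. *Conclusion.* There are positive constants $A,B,C,D$ that depend only on $L,\Delta,\rho$, and a choice of $\gamma>0$ that depends only on $L,\Delta,\rho,K,R,\sigma_g,\beta_g,\zeta_g$, such that in every such setting: 1. $\mathbb E\|g^{(k)}(\Theta)-\nabla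 F^{(k)}(\Theta)\|^2\le\sigma^2/M_k$ for all $k$ and $\Theta$; 2. $\beta\sqrt{M/(KM_{\min})}$ and $\zeta\sqrt{M/(KM_{\min})}$ satisfy the inequality that defines the inter-group heterogeneity constants; 3. for all inter-group heterogeneity constants $(\beta_g,\zeta_g)$ and all $R\ge1$, Grouped Sequential Training with the chosen $\gamma$ has $\mathbb E\|\nabla F(\Theta^{(r)})\|^2<\infty$ for all $r$, and $$\min_{0\le r\le R}\mathbb E\|\nabla F(\Theta^{(r)})\|^2\le\frac{A\sigma_g}{R^{1/2}}+\frac{B\sigma_g^{2/3}+C\zeta_g^{2/3}}{K^{1/3}R^{2/3}}+\frac{D\,(1+\beta_g^2/K)}{R}.$$ -/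

import Mathlib

open MeasureTheory ProbabilityTheory
open scoped NNReal

namespace GST

noncomputable section

/-- The parameter space `ℝ^d` with its Euclidean norm. -/
abbrev Param (d : ℕ) : Type := EuclideanSpace ℝ (Fin d)

/-! ### Objectives, groups, smoothness and heterogeneity -/

/-- The aggregate loss `F = (1/M) ∑ₘ Fₘ`. -/
def meanLoss {d M : ℕ} (F : Fin M → Param d → ℝ) : Param d → ℝ :=
  fun x => (1 / (M : ℝ)) * ∑ m, F m x

/-- The number `M_k` of datasets in group `k`. A partition of the `M` datasets into `K` groups is
given by the map `c` sending each dataset to its group. -/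
def groupSize {M K : ℕ} (c : Fin M → Fin K) (k : Fin K) : ℕ :=
  (Finset.univ.filter fun m => c m = k).card

/-- The smallest group size. -/
def minGroupSize {M K : ℕ} (c : Fin M → Fin K) : ℕ := ⨅ k, groupSize c k

/-- The group loss `F^(k) = (1/M_k) ∑_{m ∈ G_k} Fₘ`. -/
def groupLoss {d M K : ℕ} (c : Fin M → Fin K) (F : Fin M → Param d → ℝ) (k : Fin K) :
    Param d → ℝ :=
  fun x => (1 / (groupSize c k : ℝ)) * ∑ m ∈ Finset.univ.filter (fun m => c m = k), F m x

/-- `L`-smoothness: differentiable with `L`-Lipschitz gradient. -/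
def IsSmooth {d : ℕ} (L : ℝ≥0) (f : Param d → ℝ) : Prop :=
  Differentiable ℝ f ∧ LipschitzWith L (gradient f)

/-- The functions `G₁, …, G_N` have heterogeneity relative to `F` bounded by `(β, ζ)`:
`(1/N) ∑ᵢ ‖∇Gᵢ(x) - ∇F(x)‖² ≤ β² ‖∇F(x)‖² + ζ²` for all `x`. -/
def BoundedHeterogeneity {d N : ℕ} (G : Fin N → Param d → ℝ) (F : Param d → ℝ) (β ζ : ℝ) : Prop :=
  ∀ x, (1 / (N : ℝ)) * ∑ i, ‖gradient (G i) x - gradient F x‖ ^ 2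
    ≤ β ^ 2 * ‖gradient F x‖ ^ 2 + ζ ^ 2

/-! ### Stochastic gradients -/

/-- `g m x z` is the stochastic gradient of dataset `m` at `x` computed from a sample `z` with law
`P m`: it is unbiased and its variance is at most `σ²`. -/
structure IsStochasticGradient {d M : ℕ} {Ξ : Type*} [MeasurableSpace Ξ]
    (F : Fin M → Param d → ℝ) (P : Fin M → Measure Ξ) (g : Fin M → Param d → Ξ → Param d)
    (σ : ℝ) : Prop where
  measurable : ∀ m, Measurable (fun p : Param d × Ξ => g m p.1 p.2)
  integrable : ∀ m x, Integrable (g m x) (P m)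
  unbiased : ∀ m x, ∫ z, g m x z ∂(P m) = gradient (F m) x
  integrable_sq : ∀ m x, Integrable (fun z => ‖g m x z - gradient (F m) x‖ ^ 2) (P m)
  variance_le : ∀ m x, ∫ z, ‖g m x z - gradient (F m) x‖ ^ 2 ∂(P m) ≤ σ ^ 2

/-- The stochastic gradient `g^(k) = (1/M_k) ∑_{m ∈ G_k} gₘ` of group `k`; the entry `z m` is the
sample drawn from dataset `m`. -/
def groupGrad {d M K : ℕ} {Ξ : Type*} (c : Fin M → Fin K) (g : Fin M → Param d → Ξ → Param d)
    (k : Fin K) (x : Param d) (z : Fin M → Ξ) : Param d :=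
  (1 / (groupSize c k : ℝ)) • ∑ m ∈ Finset.univ.filter (fun m => c m = k), g m x (z m)

/-- The variance `𝔼 ‖g^(k)(x) - ∇F^(k)(x)‖²` of the stochastic gradient of group `k` at `x`, the
datasets being sampled independently. -/
def groupVariance {d M K : ℕ} {Ξ : Type*} [MeasurableSpace Ξ] (c : Fin M → Fin K)
    (F : Fin M → Param d → ℝ) (P : Fin M → Measure Ξ) (g : Fin M → Param d → Ξ → Param d)
    (k : Fin K) (x : Param d) : ℝ :=
  ∫ z, ‖groupGrad c g k x z - gradient (groupLoss c F k) x‖ ^ 2 ∂(Measure.pi P)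

/-- The within-group gradient noise level `σ_g`: the square root of the largest variance of a group
stochastic gradient, over all groups and all parameters. -/
def groupNoise {d M K : ℕ} {Ξ : Type*} [MeasurableSpace Ξ] (c : Fin M → Fin K)
    (F : Fin M → Param d → ℝ) (P : Fin M → Measure Ξ) (g : Fin M → Param d → Ξ → Param d) : ℝ :=
  Real.sqrt (⨆ p : Fin K × Param d, groupVariance c F P g p.1 p.2)

/-! ### Grouped Sequential Training -/

/-- Permutations carry the discrete `σ`-algebra. -/
instance instMeasurableSpacePerm (K : ℕ) : MeasurableSpace (Equiv.Perm (Fin K)) := ⊤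

/-- The randomness of one round: the order in which the groups are visited, and for each group `k`
and each of the `S k` steps made on it, one sample per dataset. -/
abbrev RoundSeed (M K : ℕ) (S : Fin K → ℕ) (Ξ : Type*) : Type _ :=
  Equiv.Perm (Fin K) × ((k : Fin K) → Fin (S k) → Fin M → Ξ)

/-- The law of the randomness of one round: a uniformly random order, and independently of it
independent samples, those of dataset `m` having law `P m`. -/
def roundLaw {M K : ℕ} {Ξ : Type*} [MeasurableSpace Ξ] (S : Fin K → ℕ) (P : Fin M → Measure Ξ) :
    Measure (RoundSeed M K S Ξ) :=
  (uniformOn (Set.univ : Set (Equiv.Perm (Fin K)))).prod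
    (Measure.pi fun k => Measure.pi fun _ : Fin (S k) => Measure.pi P)

/-- The parameter after `s` SGD steps (at most `n`) with step size `η` and gradient estimate `h`,
started at `x` and using the samples `z`. -/
def localIterate {d n : ℕ} {Z : Type*} (η : ℝ) (h : Param d → Z → Param d) (z : Fin n → Z)
    (x : Param d) : ℕ → Param d
  | 0 => x
  | s + 1 =>
    if hs : s < n then
      localIterate η h z x s - η • h (localIterate η h z x s) (z ⟨s, hs⟩)
    else localIterate η h z x s

/-- The step size used on group `k`: the total step length `γ` of a round is shared among the groups
in proportion to the number of their datasets, and equally among the `S k` steps on group `k`. -/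
def groupStep {M K : ℕ} (c : Fin M → Fin K) (S : Fin K → ℕ) (γ : ℝ) (k : Fin K) : ℝ :=
  γ * (groupSize c k : ℝ) / ((M : ℝ) * (S k : ℝ))

/-- The parameter after the first `j` group visits of a round started at `x`: the groups are trained
one after the other in the order drawn for the round, each from where the previous one ended. -/
def roundIterate {d M K : ℕ} {Ξ : Type*} (c : Fin M → Fin K) (g : Fin M → Param d → Ξ → Param d)
    (S : Fin K → ℕ) (γ : ℝ) (w : RoundSeed M K S Ξ) (x : Param d) : ℕ → Param d
  | 0 => x
  | j + 1 =>
    if hj : j < K then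
      localIterate (groupStep c S γ (w.1 ⟨j, hj⟩)) (groupGrad c g (w.1 ⟨j, hj⟩))
        (w.2 (w.1 ⟨j, hj⟩)) (roundIterate c g S γ w x j) (S (w.1 ⟨j, hj⟩))
    else roundIterate c g S γ w x j

/-- The parameter `Θ^(r)` after `r` rounds of Grouped Sequential Training started at `x₀`, for the
round seeds `w 0, w 1, …`. -/
def iterate {d M K : ℕ} {Ξ : Type*} (c : Fin M → Fin K) (g : Fin M → Param d → Ξ → Param d)
    (S : Fin K → ℕ) (γ : ℝ) (x₀ : Param d) (w : ℕ → RoundSeed M K S Ξ) : ℕ → Param d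
  | 0 => x₀
  | r + 1 => roundIterate c g S γ (w r) (iterate c g S γ x₀ w r) K

/-- `𝒞(R) = min_{0 ≤ r ≤ R} 𝔼 ‖∇F(Θ^(r))‖²`. -/
def convergenceMeasure {d : ℕ} {Ω : Type*} [MeasurableSpace Ω] (μ : Measure Ω)
    (F : Param d → ℝ) (Θ : ℕ → Ω → Param d) (R : ℕ) : ℝ :=
  ⨅ r : Fin (R + 1), ∫ a, ‖gradient F (Θ r a)‖ ^ 2 ∂μ

end

end GST

/-!
One round of Grouped Sequential Training is a gradient step of length `γ` on `F`, up to noise and up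
to the error made by evaluating the gradients along the path instead of at its start `x`. The proof
bounds the two, which gives an expected decrease of `F` per round, and sums over the rounds.

*Noise.* The noise accumulated up to any time of a round is a sum of martingale differences: the
samples of a step are independent of everything that came before (`indepFun_visit`; redrawing them
leaves the past unchanged). With total step length `γ` and group weights at most `ρ / K`, the noise
has mean zero and variance at most `γ² ρ σ_g² / K` (`isCentredWithin_visitNoise`).

*Drift.* The distance from `x` satisfies an inequality in which it is bounded by `L` times its own
weighted average plus three perturbations: the accumulated deviations of the group gradients at `x`,
the gradient of `F` at `x`, and the noise (`norm_visitIterate_sub_le`). For `2 L γ ≤ 1` the average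
can be absorbed (`sq_sum_mul_le_of_le`), so the distance is of the order of the perturbations.

*Random order.* The weighted deviations of the group gradients add up to zero. Drawn without
replacement they are negatively correlated, so that the mean square of a partial sum is at most the
sum of the squares (`sum_perm_norm_sq_sum_le`). This is where the factor `1 / K` in front of `ζ_g²`
and `β_g²` comes from.

Together these give `𝔼 F(Θ⁺) ≤ F(x) - γ/4 ‖∇F(x)‖² + O(γ³ (σ_g² + ζ_g²) / K + γ² σ_g² / K)` as soon as
`γ` is at most a constant times `1 / (1 + β_g² / K)`. The inverse of the step length is the sum of
`1 + β_g² / K`, `σ_g √R` and `((σ_g² + ζ_g²) R / K)^(1/3)`, up to a constant in the first summand, so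
that `Δ / (γ R)` splits into the three terms of the rate (`rate_le`).
-/

namespace GST

/-! ### Gradients of averages, smoothness and heterogeneity -/

section Gradients

variable {d : ℕ} {ι : Type*}

theorem hasGradientAt_const_mul_sum (s : Finset ι) (a : ℝ) (F : ι → Param d → ℝ)
    (hF : ∀ m, Differentiable ℝ (F m)) (x : Param d) :
    HasGradientAt (fun y => a * ∑ m ∈ s, F m y) (a • ∑ m ∈ s, gradient (F m) x) x := by
  have h1 : InnerProductSpace.toDual ℝ (Param d) (a • ∑ m ∈ s, gradient (F m) x) =
      a • ∑ m ∈ s, InnerProductSpace.toDual ℝ (Param d) (gradient (F m) x) := by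
    rw [map_smulₛₗ, map_sum]
    rfl
  rw [hasGradientAt_iff_hasFDerivAt, h1]
  exact (HasFDerivAt.fun_sum (u := s) fun m _ =>
    (hasGradientAt_iff_hasFDerivAt.1 (hF m x).hasGradientAt)).const_mul a

theorem gradient_const_mul_sum (s : Finset ι) (a : ℝ) (F : ι → Param d → ℝ)
    (hF : ∀ m, Differentiable ℝ (F m)) (x : Param d) :
    gradient (fun y => a * ∑ m ∈ s, F m y) x = a • ∑ m ∈ s, gradient (F m) x :=
  (hasGradientAt_const_mul_sum s a F hF x).gradient

theorem isSmooth_const_mul_sum {L : ℝ≥0} (s : Finset ι) (a : ℝ) (ha : 0 ≤ a)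
    (hs : a * (s.card : ℝ) ≤ 1) (F : ι → Param d → ℝ) (hF : ∀ m, IsSmooth L (F m)) :
    IsSmooth L (fun y => a * ∑ m ∈ s, F m y) := by
  refine ⟨fun x => (hasGradientAt_const_mul_sum s a F (fun m => (hF m).1) x).differentiableAt,
    LipschitzWith.of_dist_le_mul fun x y => ?_⟩
  rw [gradient_const_mul_sum s a F (fun m => (hF m).1),
    gradient_const_mul_sum s a F (fun m => (hF m).1), dist_eq_norm, ← smul_sub,
    ← Finset.sum_sub_distrib, norm_smul, Real.norm_of_nonneg ha]
  have h1 : ‖∑ m ∈ s, (gradient (F m) x - gradient (F m) y)‖ ≤ s.card * (L * dist x y) := by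
    refine (norm_sum_le _ _).trans ?_
    rw [← nsmul_eq_mul]
    refine Finset.sum_le_card_nsmul _ _ _ fun m _ => ?_
    rw [← dist_eq_norm]
    exact (hF m).2.dist_le_mul x y
  calc a * ‖∑ m ∈ s, (gradient (F m) x - gradient (F m) y)‖
      ≤ a * (s.card * (L * dist x y)) := by gcongr
    _ = (a * s.card) * (L * dist x y) := by ring
    _ ≤ 1 * (L * dist x y) := by gcongr
    _ = L * dist x y := one_mul _

theorem isSmooth_meanLoss {M : ℕ} {L : ℝ≥0} {F : Fin M → Param d → ℝ}
    (hF : ∀ m, IsSmooth L (F m)) : IsSmooth L (meanLoss F) := by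
  refine isSmooth_const_mul_sum Finset.univ (1 / (M : ℝ)) (by positivity) ?_ F hF
  rw [Finset.card_univ, Fintype.card_fin, one_div]
  exact inv_mul_le_one

theorem isSmooth_groupLoss {M K : ℕ} {L : ℝ≥0} {F : Fin M → Param d → ℝ} (c : Fin M → Fin K)
    (hF : ∀ m, IsSmooth L (F m)) (k : Fin K) : IsSmooth L (groupLoss c F k) := by
  refine isSmooth_const_mul_sum _ (1 / (groupSize c k : ℝ)) (by positivity) ?_ F hF
  rw [one_div]
  exact inv_mul_le_one

theorem groupSize_pos {M K : ℕ} {c : Fin M → Fin K} (hc : Function.Surjective c) (k : Fin K) :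
    0 < groupSize c k := by
  obtain ⟨m, hm⟩ := hc k
  exact Finset.card_pos.2 ⟨m, by simp [hm]⟩

theorem sum_groupSize {M K : ℕ} (c : Fin M → Fin K) : ∑ k, groupSize c k = M := by
  have h := Finset.card_eq_sum_card_fiberwise (s := Finset.univ) (t := Finset.univ) (f := c)
    (fun _ _ => by simp)
  simpa [groupSize] using h.symm

/-- The overall gradient is the average of the group gradients weighted by the group sizes. -/
theorem sum_smul_gradient_groupLoss {M K : ℕ} {L : ℝ≥0} {F : Fin M → Param d → ℝ}
    {c : Fin M → Fin K} (hc : Function.Surjective c) (hF : ∀ m, IsSmooth L (F m)) (x : Param d) :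
    ∑ k, ((groupSize c k : ℝ) / M) • gradient (groupLoss c F k) x = gradient (meanLoss F) x := by
  have h1 : gradient (meanLoss F) x = (1 / (M : ℝ)) • ∑ m, gradient (F m) x :=
    gradient_const_mul_sum _ _ F (fun m => (hF m).1) x
  rw [h1, ← Finset.sum_fiberwise Finset.univ c, Finset.smul_sum]
  refine Finset.sum_congr rfl fun k _ => ?_
  have h2 : gradient (groupLoss c F k) x = (1 / (groupSize c k : ℝ)) •
      ∑ m ∈ Finset.univ.filter (fun m => c m = k), gradient (F m) x :=
    gradient_const_mul_sum _ _ F (fun m => (hF m).1) x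
  have h3 : (groupSize c k : ℝ) ≠ 0 := by exact_mod_cast (groupSize_pos hc k).ne'
  rw [h2, smul_smul]
  congr 1
  field_simp

/-- Grouping datasets increases the heterogeneity by a factor of at most `√(M / (K M_min))`: by
Jensen's inequality each group deviates by at most the average of its members. -/
theorem boundedHeterogeneity_groupLoss {M K : ℕ} {L : ℝ≥0} {F : Fin M → Param d → ℝ}
    (hM : 0 < M) {c : Fin M → Fin K} (hc : Function.Surjective c) (hF : ∀ m, IsSmooth L (F m))
    {β ζ : ℝ} (h : BoundedHeterogeneity F (meanLoss F) β ζ) :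
    BoundedHeterogeneity (groupLoss c F) (meanLoss F)
      (Real.sqrt ((M : ℝ) / ((K : ℝ) * (minGroupSize c : ℝ))) * β)
      (Real.sqrt ((M : ℝ) / ((K : ℝ) * (minGroupSize c : ℝ))) * ζ) := by
  intro x
  have : Nonempty (Fin K) := ⟨c ⟨0, hM⟩⟩
  have hK : 0 < K := Fin.pos_iff_nonempty.2 inferInstance
  have hmin : 0 < minGroupSize c := by
    obtain ⟨k, hk⟩ := ciInf_mem (groupSize c)
    rw [minGroupSize, ← hk]
    exact groupSize_pos hc k
  have hle : ∀ k, minGroupSize c ≤ groupSize c k := fun k => ciInf_le' _ k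
  have hM' : (0 : ℝ) < M := by exact_mod_cast hM
  have hK' : (0 : ℝ) < K := by exact_mod_cast hK
  have hmin' : (0 : ℝ) < minGroupSize c := by exact_mod_cast hmin
  set G := gradient (meanLoss F) x with hG
  set q : ℝ := (M : ℝ) / ((K : ℝ) * (minGroupSize c : ℝ)) with hq
  have hq0 : 0 ≤ q := by positivity
  have key : ∀ k, ‖gradient (groupLoss c F k) x - G‖ ^ 2 ≤
      (1 / (minGroupSize c : ℝ)) *
        ∑ m ∈ Finset.univ.filter (fun m => c m = k), ‖gradient (F m) x - G‖ ^ 2 := by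
    intro k
    have hk : (0 : ℝ) < groupSize c k := by exact_mod_cast groupSize_pos hc k
    have h2 : gradient (groupLoss c F k) x - G = (1 / (groupSize c k : ℝ)) •
        ∑ m ∈ Finset.univ.filter (fun m => c m = k), (gradient (F m) x - G) := by
      have h3 : gradient (groupLoss c F k) x = (1 / (groupSize c k : ℝ)) •
          ∑ m ∈ Finset.univ.filter (fun m => c m = k), gradient (F m) x :=
        gradient_const_mul_sum _ _ F (fun m => (hF m).1) x
      rw [Finset.sum_sub_distrib, Finset.sum_const, h3, smul_sub]
      change _ = _ - (1 / (groupSize c k : ℝ)) • (groupSize c k • G)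
      rw [← Nat.cast_smul_eq_nsmul ℝ, smul_smul, one_div_mul_cancel hk.ne', one_smul]
    rw [h2, norm_smul, mul_pow, Real.norm_of_nonneg (by positivity)]
    have h4 : ‖∑ m ∈ Finset.univ.filter (fun m => c m = k), (gradient (F m) x - G)‖ ^ 2 ≤
        groupSize c k *
          ∑ m ∈ Finset.univ.filter (fun m => c m = k), ‖gradient (F m) x - G‖ ^ 2 :=
      (pow_le_pow_left₀ (norm_nonneg _) (norm_sum_le _ _) 2).trans sq_sum_le_card_mul_sum_sq
    set Q := ∑ m ∈ Finset.univ.filter (fun m => c m = k), ‖gradient (F m) x - G‖ ^ 2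
    have hQ : 0 ≤ Q := Finset.sum_nonneg fun _ _ => by positivity
    calc (1 / (groupSize c k : ℝ)) ^ 2 * _
        ≤ (1 / (groupSize c k : ℝ)) ^ 2 * (groupSize c k * Q) := by gcongr
      _ = (1 / (groupSize c k : ℝ)) * Q := by field_simp
      _ ≤ (1 / (minGroupSize c : ℝ)) * Q := by
          gcongr
          exact_mod_cast hle k
  calc (1 / (K : ℝ)) * ∑ k, ‖gradient (groupLoss c F k) x - G‖ ^ 2
      ≤ (1 / (K : ℝ)) * ∑ k, (1 / (minGroupSize c : ℝ)) *
        ∑ m ∈ Finset.univ.filter (fun m => c m = k), ‖gradient (F m) x - G‖ ^ 2 := by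
        gcongr with k
        exact key k
    _ = q * ((1 / (M : ℝ)) * ∑ m, ‖gradient (F m) x - G‖ ^ 2) := by
        rw [← Finset.mul_sum, Finset.sum_fiberwise Finset.univ c, hq]
        field_simp
    _ ≤ q * (β ^ 2 * ‖G‖ ^ 2 + ζ ^ 2) := by
        gcongr
        exact h x
    _ = (Real.sqrt q * β) ^ 2 * ‖G‖ ^ 2 + (Real.sqrt q * ζ) ^ 2 := by
        rw [mul_pow, mul_pow, Real.sq_sqrt hq0]
        ring

/-- A second-order upper bound on a smooth function. The mean value inequality gives it with the
constant `L`; the optimal constant `L / 2` is not needed. -/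
theorem abs_sub_sub_inner_gradient_le {L : ℝ≥0} {f : Param d → ℝ} (hf : IsSmooth L f)
    (x y : Param d) :
    |f y - f x - inner ℝ (gradient f x) (y - x)| ≤ L * ‖y - x‖ ^ 2 := by
  have h := Convex.norm_image_sub_le_of_norm_hasFDerivWithin_le' (𝕜 := ℝ) (f := f)
    (f' := fun z => fderiv ℝ f z) (φ := fderiv ℝ f x) (C := L * ‖y - x‖) (s := segment ℝ x y)
    (x := x) (y := y) (fun z _ => (hf.1 z).hasFDerivAt.hasFDerivWithinAt) (fun z hz => ?_)
    (convex_segment x y) (left_mem_segment ℝ x y) (right_mem_segment ℝ x y)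
  · rw [inner_gradient_left, ← Real.norm_eq_abs]
    refine h.trans_eq (by ring)
  · rw [← toDual_gradient (𝕜 := ℝ), ← toDual_gradient (𝕜 := ℝ), ← map_sub,
      LinearIsometryEquiv.norm_map, ← dist_eq_norm]
    refine (hf.2.dist_le_mul z x).trans ?_
    gcongr
    rw [dist_eq_norm]
    obtain ⟨t, ht, rfl⟩ := (segment_eq_image' ℝ x y) ▸ hz
    rw [add_sub_cancel_left, norm_smul, Real.norm_of_nonneg ht.1]
    exact mul_le_of_le_one_left (norm_nonneg _) ht.2

end Gradients

/-! ### Partial sums in a random order -/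

section Permutations

variable {ι E : Type*} [Fintype ι] [DecidableEq ι] [NormedAddCommGroup E] [InnerProductSpace ℝ E]

/-- Values drawn without replacement from a family with sum zero are negatively correlated: the
correlation is the same for all pairs of distinct positions, and over all `i'` (including `i`) the
correlations with position `i` add up to zero. -/
theorem sum_perm_inner_nonpos {v : ι → E} (hv : ∑ k, v k = 0) {i j : ι} (hij : i ≠ j) :
    ∑ π : Equiv.Perm ι, inner ℝ (v (π i)) (v (π j)) ≤ 0 := by
  by_contra! hpos
  have hconst : ∀ l ∈ Finset.univ.erase i,
      ∑ π : Equiv.Perm ι, inner ℝ (v (π i)) (v (π l)) =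
        ∑ π : Equiv.Perm ι, inner ℝ (v (π i)) (v (π j)) := by
    intro l hl
    have hl' : i ≠ l := (Finset.ne_of_mem_erase hl).symm
    refine Fintype.sum_equiv (Equiv.mulRight (Equiv.swap j l)) _ _ fun π => ?_
    simp [Equiv.swap_apply_of_ne_of_ne hij hl']
  have h1 : 0 < ∑ l ∈ Finset.univ.erase i, ∑ π : Equiv.Perm ι, inner ℝ (v (π i)) (v (π l)) :=
    Finset.sum_pos (fun l hl => by rw [hconst l hl]; exact hpos) ⟨j, by simp [hij.symm]⟩
  rw [Finset.sum_comm] at h1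
  refine absurd h1 (not_lt.2 (Finset.sum_nonpos fun π _ => ?_))
  have h2 : ∑ l, v (π l) = 0 := by rw [Equiv.sum_comp π v, hv]
  rw [← inner_sum, ← Finset.sum_erase_add _ _ (Finset.mem_univ i)] at *
  rw [eq_neg_of_add_eq_zero_left h2, inner_neg_right, real_inner_self_eq_norm_sq]
  nlinarith [sq_nonneg ‖v (π i)‖]

theorem sum_perm_norm_sq_sum_le {v : ι → E} (hv : ∑ k, v k = 0) (s : Finset ι) :
    ∑ π : Equiv.Perm ι, ‖∑ i ∈ s, v (π i)‖ ^ 2 ≤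
      (Fintype.card (Equiv.Perm ι) : ℝ) * ∑ k, ‖v k‖ ^ 2 := by
  have h1 : ∀ π : Equiv.Perm ι, ‖∑ i ∈ s, v (π i)‖ ^ 2 =
      ∑ i ∈ s, ∑ j ∈ s, inner ℝ (v (π i)) (v (π j)) := by
    intro π
    rw [← real_inner_self_eq_norm_sq, sum_inner]
    exact Finset.sum_congr rfl fun i _ => inner_sum _ _ _
  calc ∑ π : Equiv.Perm ι, ‖∑ i ∈ s, v (π i)‖ ^ 2
      = ∑ i ∈ s, ∑ j ∈ s, ∑ π : Equiv.Perm ι, inner ℝ (v (π i)) (v (π j)) := by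
        rw [Finset.sum_congr rfl fun π _ => h1 π, Finset.sum_comm]
        exact Finset.sum_congr rfl fun i _ => Finset.sum_comm
    _ ≤ ∑ i ∈ s, ∑ π : Equiv.Perm ι, ‖v (π i)‖ ^ 2 := by
        refine Finset.sum_le_sum fun i hi => ?_
        rw [← Finset.add_sum_erase _ _ hi]
        have h2 := Finset.sum_nonpos (s := s.erase i) (f := fun j =>
          ∑ π : Equiv.Perm ι, inner ℝ (v (π i)) (v (π j)))
          fun j hj => sum_perm_inner_nonpos hv (Finset.ne_of_mem_erase hj).symm
        simp only [real_inner_self_eq_norm_sq]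
        linarith
    _ ≤ ∑ i, ∑ π : Equiv.Perm ι, ‖v (π i)‖ ^ 2 :=
        Finset.sum_le_univ_sum_of_nonneg fun i => Finset.sum_nonneg fun _ _ => by positivity
    _ = ∑ π : Equiv.Perm ι, ∑ k, ‖v k‖ ^ 2 := by
        rw [Finset.sum_comm]
        exact Finset.sum_congr rfl fun π _ => Equiv.sum_comp π fun k => ‖v k‖ ^ 2
    _ = _ := by rw [Finset.sum_const, nsmul_eq_mul, Finset.card_univ]

end Permutations

/-! ### The noise of the group gradients -/

theorem integrable_inner_of_memLp_two {α E : Type*} [MeasurableSpace α] {μ : Measure α}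
    [NormedAddCommGroup E] [InnerProductSpace ℝ E] {X Y : α → E} (hX : MemLp X 2 μ)
    (hY : MemLp Y 2 μ) : Integrable (fun a => inner ℝ (X a) (Y a)) μ :=
  (hX.norm.integrable_mul hY.norm).mono (hX.1.inner hY.1) <| Filter.Eventually.of_forall fun a => by
    simpa using abs_real_inner_le_norm (X a) (Y a)

section GroupNoise

variable {d M K : ℕ} {Ξ : Type*} {L : ℝ≥0} {F : Fin M → Param d → ℝ} {c : Fin M → Fin K}
  {g : Fin M → Param d → Ξ → Param d} {σ : ℝ}

/-- The error `g^(k)(x) - ∇F^(k)(x)` of the stochastic gradient of group `k`. -/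
noncomputable def groupError (c : Fin M → Fin K) (F : Fin M → Param d → ℝ)
    (g : Fin M → Param d → Ξ → Param d) (k : Fin K) (x : Param d) (z : Fin M → Ξ) : Param d :=
  groupGrad c g k x z - gradient (groupLoss c F k) x

theorem groupError_eq (hF : ∀ m, IsSmooth L (F m)) (k : Fin K) (x : Param d) (z : Fin M → Ξ) :
    groupError c F g k x z = (1 / (groupSize c k : ℝ)) •
      ∑ m ∈ Finset.univ.filter (fun m => c m = k), (g m x (z m) - gradient (F m) x) := by
  have h3 : gradient (groupLoss c F k) x = (1 / (groupSize c k : ℝ)) •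
      ∑ m ∈ Finset.univ.filter (fun m => c m = k), gradient (F m) x :=
    gradient_const_mul_sum _ _ F (fun m => (hF m).1) x
  rw [groupError, h3, groupGrad, ← smul_sub, Finset.sum_sub_distrib]

variable [MeasurableSpace Ξ] {P : Fin M → Measure Ξ}

theorem measurable_groupGrad (hg : IsStochasticGradient F P g σ) (k : Fin K) :
    Measurable fun p : Param d × (Fin M → Ξ) => groupGrad c g k p.1 p.2 := by
  have h : ∀ m, Measurable fun p : Param d × (Fin M → Ξ) => g m p.1 (p.2 m) := fun m =>
    (hg.measurable m).comp
      (measurable_fst.prodMk ((measurable_pi_apply m).comp measurable_snd))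
  exact (Finset.measurable_fun_sum _ fun m _ => h m).const_smul (1 / (groupSize c k : ℝ))

theorem IsSmooth.measurable_gradient {f : Param d → ℝ} (hf : IsSmooth L f) :
    Measurable (gradient f) :=
  hf.2.continuous.measurable

theorem measurable_groupError (hF : ∀ m, IsSmooth L (F m)) (hg : IsStochasticGradient F P g σ)
    (k : Fin K) :
    Measurable fun p : Param d × (Fin M → Ξ) => groupError c F g k p.1 p.2 :=
  (measurable_groupGrad hg k).sub
    ((isSmooth_groupLoss c hF k).measurable_gradient.comp measurable_fst)

theorem groupVariance_nonneg (k : Fin K) (x : Param d) : 0 ≤ groupVariance c F P g k x :=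
  integral_nonneg fun _ => by positivity

theorem groupNoise_nonneg : 0 ≤ groupNoise c F P g := Real.sqrt_nonneg _

theorem memLp_sub_gradient (hg : IsStochasticGradient F P g σ) (m : Fin M) (x : Param d) :
    MemLp (fun z => g m x z - gradient (F m) x) 2 (P m) :=
  (memLp_two_iff_integrable_sq_norm
    ((hg.integrable m x).1.sub aestronglyMeasurable_const)).2 (hg.integrable_sq m x)

variable [∀ m, IsProbabilityMeasure (P m)]

theorem integral_sub_gradient (hg : IsStochasticGradient F P g σ) (m : Fin M) (x : Param d) :
    ∫ z, (g m x z - gradient (F m) x) ∂(P m) = 0 := by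
  rw [integral_sub (hg.integrable m x) (integrable_const _), hg.unbiased]
  simp

theorem memLp_sub_gradient_pi (hg : IsStochasticGradient F P g σ) (m : Fin M) (x : Param d) :
    MemLp (fun z : Fin M → Ξ => g m x (z m) - gradient (F m) x) 2 (Measure.pi P) :=
  (memLp_sub_gradient hg m x).comp_measurePreserving (measurePreserving_eval P m)

theorem integral_sub_gradient_pi (hg : IsStochasticGradient F P g σ) (m : Fin M) (x : Param d) :
    ∫ z : Fin M → Ξ, (g m x (z m) - gradient (F m) x) ∂(Measure.pi P) = 0 := by
  rw [integral_comp_eval (μ := P) (f := fun z => g m x z - gradient (F m) x)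
    (memLp_sub_gradient hg m x).1, integral_sub_gradient hg]

theorem memLp_groupError (hF : ∀ m, IsSmooth L (F m)) (hg : IsStochasticGradient F P g σ)
    (k : Fin K) (x : Param d) : MemLp (groupError c F g k x) 2 (Measure.pi P) := by
  rw [funext fun z => groupError_eq (c := c) (g := g) hF k x z]
  have h := memLp_finsetSum (Finset.univ.filter fun m => c m = k)
    fun m _ => memLp_sub_gradient_pi hg m x
  exact h.const_smul (1 / (groupSize c k : ℝ))

theorem integral_groupError (hF : ∀ m, IsSmooth L (F m)) (hg : IsStochasticGradient F P g σ)
    (k : Fin K) (x : Param d) : ∫ z, groupError c F g k x z ∂(Measure.pi P) = 0 := by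
  simp_rw [groupError_eq (c := c) (g := g) hF k x]
  rw [integral_smul, integral_finsetSum _
    fun m _ => (memLp_sub_gradient_pi hg m x).integrable one_le_two]
  simp [integral_sub_gradient_pi hg]

/-- The samples of different datasets are independent, so averaging over a group divides the
variance by the group size. -/
theorem groupVariance_le (hc : Function.Surjective c) (hF : ∀ m, IsSmooth L (F m))
    (hg : IsStochasticGradient F P g σ) (k : Fin K) (x : Param d) :
    groupVariance c F P g k x ≤ σ ^ 2 / (groupSize c k : ℝ) := by
  set X : Fin M → (Fin M → Ξ) → Param d := fun m z => g m x (z m) - gradient (F m) x with hX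
  have hL2 : ∀ m, MemLp (X m) 2 (Measure.pi P) := fun m => memLp_sub_gradient_pi hg m x
  have hind : iIndepFun X (Measure.pi P) :=
    iIndepFun_pi (X := fun m z => g m x z - gradient (F m) x)
      fun m => (memLp_sub_gradient hg m x).1.aemeasurable
  have hcross : ∀ m m', m ≠ m' → ∫ z, inner ℝ (X m z) (X m' z) ∂(Measure.pi P) = 0 := by
    intro m m' hmm
    have h := (hind.indepFun hmm).integral_bilin ((hL2 m).integrable one_le_two)
      ((hL2 m').integrable one_le_two) (innerSL ℝ)
    refine h.trans ?_
    rw [integral_sub_gradient_pi hg m x, map_zero, zero_apply]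
  have hself : ∀ m, ∫ z, inner ℝ (X m z) (X m z) ∂(Measure.pi P) ≤ σ ^ 2 := by
    intro m
    simp_rw [real_inner_self_eq_norm_sq, hX]
    rw [integral_comp_eval (μ := P) (f := fun z => ‖g m x z - gradient (F m) x‖ ^ 2)
      (hg.integrable_sq m x).1]
    exact hg.variance_le m x
  have hk : (0 : ℝ) < groupSize c k := by exact_mod_cast groupSize_pos hc k
  set s := Finset.univ.filter fun m => c m = k with hs
  have hexp : ∀ z, ‖groupGrad c g k x z - gradient (groupLoss c F k) x‖ ^ 2 =
      (1 / (groupSize c k : ℝ)) ^ 2 * ∑ m ∈ s, ∑ m' ∈ s, inner ℝ (X m z) (X m' z) := by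
    intro z
    change ‖groupError c F g k x z‖ ^ 2 = _
    rw [groupError_eq hF, norm_smul, mul_pow, Real.norm_of_nonneg (by positivity),
      ← real_inner_self_eq_norm_sq, sum_inner]
    congr 1
    exact Finset.sum_congr rfl fun i _ => inner_sum _ _ _
  have hint : ∀ m m', Integrable (fun z => inner ℝ (X m z) (X m' z)) (Measure.pi P) :=
    fun m m' => integrable_inner_of_memLp_two (hL2 m) (hL2 m')
  rw [groupVariance, integral_congr_ae (Filter.Eventually.of_forall hexp),
    integral_const_mul, integral_finsetSum _
      fun m _ => integrable_finsetSum _ fun m' _ => hint m m']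
  calc (1 / (groupSize c k : ℝ)) ^ 2 *
        ∑ m ∈ s, ∫ z, ∑ m' ∈ s, inner ℝ (X m z) (X m' z) ∂(Measure.pi P)
      ≤ (1 / (groupSize c k : ℝ)) ^ 2 * ∑ m ∈ s, σ ^ 2 := by
        gcongr with m hm
        rw [integral_finsetSum _ fun m' _ => hint m m',
          Finset.sum_eq_single_of_mem m hm fun m' _ h => hcross m m' h.symm]
        exact hself m
    _ = σ ^ 2 / (groupSize c k : ℝ) := by
        rw [Finset.sum_const, nsmul_eq_mul]
        change (1 / (groupSize c k : ℝ)) ^ 2 * ((groupSize c k : ℝ) * σ ^ 2) = _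
        field_simp

/-- The supremum that defines `groupNoise` is finite, hence an upper bound. -/
theorem integral_groupError_sq_le (hc : Function.Surjective c) (hF : ∀ m, IsSmooth L (F m))
    (hg : IsStochasticGradient F P g σ) (k : Fin K) (x : Param d) :
    ∫ z, ‖groupError c F g k x z‖ ^ 2 ∂(Measure.pi P) ≤ groupNoise c F P g ^ 2 := by
  rw [groupNoise, Real.sq_sqrt (Real.iSup_nonneg fun _ => groupVariance_nonneg _ _)]
  refine le_ciSup (f := fun p : Fin K × Param d => groupVariance c F P g p.1 p.2)
    ⟨σ ^ 2, ?_⟩ (k, x)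
  rintro _ ⟨p, rfl⟩
  refine (groupVariance_le hc hF hg p.1 p.2).trans (div_le_self (sq_nonneg σ) ?_)
  exact_mod_cast groupSize_pos hc p.1

end GroupNoise

/-! ### Fresh samples -/

section Resampling

variable {ι : Type*} [Fintype ι] [DecidableEq ι] {X : ι → Type*} [∀ i, MeasurableSpace (X i)]
  (μ : ∀ i, Measure (X i)) [∀ i, IsProbabilityMeasure (μ i)] {Y : Type*} [MeasurableSpace Y]
  (ν : Measure Y) [IsProbabilityMeasure ν]

/-- If replacing a sample of `μ k` by `φ` of it and of an independent sample of `ν` preserves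
`μ k`, then doing so in the coordinate `k` preserves the product measure. -/
theorem measurePreserving_update (k : ι) {φ : X k × Y → X k}
    (hφ : MeasurePreserving φ ((μ k).prod ν) (μ k)) :
    MeasurePreserving (fun p : (∀ i, X i) × Y => Function.update p.1 k (φ (p.1 k, p.2)))
      ((Measure.pi μ).prod ν) (Measure.pi μ) := by
  have hmeas : Measurable
      (fun p : (∀ i, X i) × Y => Function.update p.1 k (φ (p.1 k, p.2))) := by
    refine measurable_pi_iff.2 fun i => ?_
    by_cases h : i = k
    · subst h
      simp only [Function.update_self]
      exact hφ.measurable.comp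
        (((measurable_pi_apply i).comp measurable_fst).prodMk measurable_snd)
    · simp only [Function.update_of_ne h]
      exact (measurable_pi_apply i).comp measurable_fst
  refine ⟨hmeas, (Measure.pi_eq fun s hs => ?_).symm⟩
  have hbox : MeasurableSet (Set.univ.pi s) := MeasurableSet.univ_pi hs
  rw [Measure.map_apply hmeas hbox, Measure.prod_apply_symm (hmeas hbox)]
  have hsec : ∀ y, (fun x : ∀ i, X i => (x, y)) ⁻¹'
      ((fun p : (∀ i, X i) × Y => Function.update p.1 k (φ (p.1 k, p.2))) ⁻¹' Set.univ.pi s) =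
      Set.univ.pi (Function.update s k {v | φ (v, y) ∈ s k}) := by
    intro y
    ext x
    simp only [Set.mem_preimage, Set.mem_univ_pi]
    refine forall_congr' fun i => ?_
    by_cases h : i = k
    · subst h
      simp
    · simp [Function.update_of_ne h]
  have hprod : ∀ y, Measure.pi μ (Set.univ.pi (Function.update s k {v | φ (v, y) ∈ s k})) =
      (∏ i ∈ Finset.univ.erase k, μ i (s i)) * μ k {v | φ (v, y) ∈ s k} := by
    intro y
    rw [Measure.pi_pi, ← Finset.prod_erase_mul _ _ (Finset.mem_univ k), Function.update_self]
    congr 1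
    refine Finset.prod_congr rfl fun i hi => ?_
    rw [Function.update_of_ne (Finset.ne_of_mem_erase hi)]
  have hfac : ∫⁻ y, μ k {v | φ (v, y) ∈ s k} ∂ν = μ k (s k) := by
    rw [← hφ.measure_preimage (hs k).nullMeasurableSet,
      Measure.prod_apply_symm (hφ.measurable (hs k))]
    rfl
  simp_rw [hsec, hprod]
  have hsecmeas : Measurable fun y => μ k {v | φ (v, y) ∈ s k} :=
    measurable_measure_prodMk_right (hφ.measurable (hs k))
  rw [lintegral_const_mul _ hsecmeas, hfac, Finset.prod_erase_mul _ _ (Finset.mem_univ k)]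

/-- Redrawing one coordinate preserves a product measure. -/
theorem measurePreserving_update_snd (k : ι) :
    MeasurePreserving (fun p : (∀ i, X i) × X k => Function.update p.1 k p.2)
      ((Measure.pi μ).prod (μ k)) (Measure.pi μ) :=
  measurePreserving_update μ (μ k) k (φ := Prod.snd) measurePreserving_snd

/-- If `U` redraws the observable `Z` and leaves `T` as it is, then `T` and `Z` are independent. -/
theorem indepFun_of_measurePreserving {Ω S Z : Type*} [MeasurableSpace Ω] [MeasurableSpace S]
    [MeasurableSpace Z] {P : Measure Ω} [IsProbabilityMeasure P] {Q : Measure Z}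
    [IsProbabilityMeasure Q] {U : Ω × Z → Ω} (hU : MeasurePreserving U (P.prod Q) P)
    {T : Ω → S} {V : Ω → Z} (hT : Measurable T) (hV : Measurable V)
    (hTU : ∀ ω z, T (U (ω, z)) = T ω) (hVU : ∀ ω z, V (U (ω, z)) = z) :
    T ⟂ᵢ[P] V ∧ P.map V = Q := by
  have hlaw : P.map V = Q := by
    rw [← hU.map_eq, Measure.map_map hV hU.measurable]
    have : V ∘ U = Prod.snd := funext fun p => hVU p.1 p.2
    rw [this]
    exact (measurePreserving_snd (μ := P) (ν := Q)).map_eq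
  refine ⟨?_, hlaw⟩
  rw [indepFun_iff_map_prod_eq_prod_map_map hT.aemeasurable hV.aemeasurable, hlaw]
  have h1 : P.map (fun ω => (T ω, V ω)) = (P.prod Q).map (Prod.map T id) := by
    conv_lhs => rw [← hU.map_eq]
    rw [Measure.map_map (hT.prodMk hV) hU.measurable]
    congr 1
    ext1 p
    exact Prod.ext (hTU p.1 p.2) (hVU p.1 p.2)
  rw [h1, ← Measure.map_prod_map _ _ hT measurable_id, Measure.map_id]

end Resampling

section Independence

variable {Ω S Z : Type*} [MeasurableSpace Ω] [MeasurableSpace S] [MeasurableSpace Z]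
  {P : Measure Ω} [IsProbabilityMeasure P] {Q : Measure Z} {T : Ω → S} {V : Ω → Z} {E : Type*}
  [NormedAddCommGroup E]

theorem integrable_prod_of_indepFun (hT : Measurable T) (hV : Measurable V) (hind : T ⟂ᵢ[P] V)
    (hlaw : P.map V = Q) {f : S × Z → E} (hf : StronglyMeasurable f)
    (hint : Integrable (fun ω => f (T ω, V ω)) P) : Integrable f ((P.map T).prod Q) := by
  have hmap := (indepFun_iff_map_prod_eq_prod_map_map hT.aemeasurable hV.aemeasurable).1 hind
  rw [hlaw] at hmap
  rw [← hmap]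
  exact (integrable_map_measure hf.aestronglyMeasurable (hT.prodMk hV).aemeasurable).2 hint

variable [IsProbabilityMeasure Q]

theorem integrable_integral_comp_of_indepFun [NormedSpace ℝ E] (hT : Measurable T)
    (hV : Measurable V) (hind : T ⟂ᵢ[P] V) (hlaw : P.map V = Q) {f : S × Z → E}
    (hf : StronglyMeasurable f) (hint : Integrable (fun ω => f (T ω, V ω)) P) :
    Integrable (fun ω => ∫ z, f (T ω, z) ∂Q) P :=
  (integrable_prod_of_indepFun hT hV hind hlaw hf hint).integral_prod_left.comp_measurable hT

/-- The expectation of a function of two independent variables can be taken in two steps. -/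
theorem integral_comp_of_indepFun [NormedSpace ℝ E] (hT : Measurable T) (hV : Measurable V)
    (hind : T ⟂ᵢ[P] V) (hlaw : P.map V = Q) {f : S × Z → E} (hf : StronglyMeasurable f)
    (hint : Integrable (fun ω => f (T ω, V ω)) P) :
    ∫ ω, f (T ω, V ω) ∂P = ∫ ω, ∫ z, f (T ω, z) ∂Q ∂P := by
  have hmap := (indepFun_iff_map_prod_eq_prod_map_map hT.aemeasurable hV.aemeasurable).1 hind
  rw [hlaw] at hmap
  have : IsProbabilityMeasure (P.map T) := Measure.isProbabilityMeasure_map hT.aemeasurable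
  have h1 := integrable_prod_of_indepFun hT hV hind hlaw hf hint
  rw [← integral_map (φ := fun ω => (T ω, V ω)) (hT.prodMk hV).aemeasurable
    hf.aestronglyMeasurable, hmap, integral_prod _ h1,
    integral_map hT.aemeasurable h1.1.integral_prod_right']

theorem integrable_comp_of_indepFun (hT : Measurable T) (hV : Measurable V) (hind : T ⟂ᵢ[P] V)
    (hlaw : P.map V = Q) {f : S × Z → E} (hf : StronglyMeasurable f)
    (hint : ∀ t, Integrable (fun z => f (t, z)) Q) {b : Ω → ℝ} (hb : Integrable b P)
    (hle : ∀ ω, ∫ z, ‖f (T ω, z)‖ ∂Q ≤ b ω) :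
    Integrable (fun ω => f (T ω, V ω)) P := by
  have hmap := (indepFun_iff_map_prod_eq_prod_map_map hT.aemeasurable hV.aemeasurable).1 hind
  rw [hlaw] at hmap
  have : IsProbabilityMeasure (P.map T) := Measure.isProbabilityMeasure_map hT.aemeasurable
  have hmeas : StronglyMeasurable fun t => ∫ z, ‖f (t, z)‖ ∂Q := hf.norm.integral_prod_right'
  rw [← Function.comp_def f, ← integrable_map_measure hf.aestronglyMeasurable
    (hT.prodMk hV).aemeasurable, hmap, integrable_prod_iff hf.aestronglyMeasurable]
  refine ⟨Filter.Eventually.of_forall hint, ?_⟩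
  rw [integrable_map_measure hmeas.aestronglyMeasurable hT.aemeasurable]
  refine hb.mono' (hmeas.comp_measurable hT).aestronglyMeasurable
    (Filter.Eventually.of_forall fun ω => ?_)
  rw [Function.comp_apply, Real.norm_of_nonneg (integral_nonneg fun _ => norm_nonneg _)]
  exact hle ω

end Independence

/-- Adding a centred increment computed from a fresh sample `V` and the current position `y` keeps
the mean and adds at most the variance of the increment to the second moment. -/
theorem moments_add_smul_of_indepFun {d : ℕ} {Ω Z : Type*} [MeasurableSpace Ω]
    [MeasurableSpace Z] {P : Measure Ω} [IsProbabilityMeasure P] {Q : Measure Z}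
    [IsProbabilityMeasure Q] {N y : Ω → Param d} {V : Ω → Z} {h : Param d × Z → Param d} {s η : ℝ}
    (hy : Measurable y) (hNm : Measurable N) (hV : Measurable V)
    (hind : (fun ω => (N ω, y ω)) ⟂ᵢ[P] V) (hlaw : P.map V = Q) (hN : MemLp N 2 P)
    (hh : Measurable h) (hh2 : ∀ x, MemLp (fun z => h (x, z)) 2 Q)
    (hh0 : ∀ x, ∫ z, h (x, z) ∂Q = 0) (hhs : ∀ x, ∫ z, ‖h (x, z)‖ ^ 2 ∂Q ≤ s ^ 2) :
    MemLp (fun ω => N ω + η • h (y ω, V ω)) 2 P ∧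
    ∫ ω, (N ω + η • h (y ω, V ω)) ∂P = ∫ ω, N ω ∂P ∧
    ∫ ω, ‖N ω + η • h (y ω, V ω)‖ ^ 2 ∂P ≤ ∫ ω, ‖N ω‖ ^ 2 ∂P + η ^ 2 * s ^ 2 := by
  have hT : Measurable fun ω => (N ω, y ω) := hNm.prodMk hy
  have hmeas1 : Measurable fun p : (Param d × Param d) × Z => h (p.1.2, p.2) :=
    hh.comp ((measurable_snd.comp measurable_fst).prodMk measurable_snd)
  have hsq_int : ∀ x, Integrable (fun z => ‖h (x, z)‖ ^ 2) Q := fun x =>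
    (memLp_two_iff_integrable_sq_norm (hh2 x).1).1 (hh2 x)
  have hsq : Integrable (fun ω => ‖h (y ω, V ω)‖ ^ 2) P := by
    refine integrable_comp_of_indepFun (f := fun p : (Param d × Param d) × Z =>
      ‖h (p.1.2, p.2)‖ ^ 2) hT hV hind hlaw (hmeas1.norm.pow_const 2).stronglyMeasurable
      (fun t => hsq_int t.2) (integrable_const (s ^ 2)) fun ω => ?_
    simp only [norm_pow, norm_norm]
    exact hhs (y ω)
  have hmeas2 : Measurable fun ω => h (y ω, V ω) := hh.comp (hy.prodMk hV)
  have hL2 : MemLp (fun ω => h (y ω, V ω)) 2 P :=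
    (memLp_two_iff_integrable_sq_norm hmeas2.aestronglyMeasurable).2 hsq
  have hsq_le : ∫ ω, ‖h (y ω, V ω)‖ ^ 2 ∂P ≤ s ^ 2 := by
    rw [integral_comp_of_indepFun (f := fun p : (Param d × Param d) × Z =>
      ‖h (p.1.2, p.2)‖ ^ 2) hT hV hind hlaw (hmeas1.norm.pow_const 2).stronglyMeasurable hsq]
    refine (integral_mono_of_nonneg
      (Filter.Eventually.of_forall fun ω => integral_nonneg fun _ => by positivity)
      (integrable_const (s ^ 2)) (Filter.Eventually.of_forall fun ω => hhs (y ω))).trans ?_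
    simp
  have hmean : ∫ ω, h (y ω, V ω) ∂P = 0 := by
    rw [integral_comp_of_indepFun (f := fun p : (Param d × Param d) × Z => h (p.1.2, p.2))
      hT hV hind hlaw hmeas1.stronglyMeasurable (hL2.integrable one_le_two)]
    simp [hh0]
  have hcross : ∫ ω, inner ℝ (N ω) (h (y ω, V ω)) ∂P = 0 := by
    rw [integral_comp_of_indepFun (f := fun p : (Param d × Param d) × Z =>
      inner ℝ p.1.1 (h (p.1.2, p.2))) hT hV hind hlaw
      ((measurable_fst.comp measurable_fst).inner hmeas1).stronglyMeasurable
      (integrable_inner_of_memLp_two hN hL2)]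
    have : ∀ ω, ∫ z, inner ℝ (N ω) (h (y ω, z)) ∂Q = 0 := fun ω => by
      rw [integral_inner ((hh2 (y ω)).integrable one_le_two), hh0, inner_zero_right]
    simp [this]
  refine ⟨hN.add (hL2.const_smul η), ?_, ?_⟩
  · rw [integral_add (g := fun ω => η • h (y ω, V ω)) (hN.integrable one_le_two)
      ((hL2.const_smul η).integrable one_le_two), integral_smul, hmean, smul_zero, add_zero]
  · have hexp : ∀ ω, ‖N ω + η • h (y ω, V ω)‖ ^ 2 =
        ‖N ω‖ ^ 2 + 2 * η * inner ℝ (N ω) (h (y ω, V ω)) + η ^ 2 * ‖h (y ω, V ω)‖ ^ 2 := by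
      intro ω
      rw [norm_add_sq_real, inner_smul_right, norm_smul, mul_pow, Real.norm_eq_abs, sq_abs]
      ring
    have hN2 := (memLp_two_iff_integrable_sq_norm hN.1).1 hN
    have hin := integrable_inner_of_memLp_two hN hL2
    simp_rw [hexp]
    rw [integral_add (f := fun ω => ‖N ω‖ ^ 2 + 2 * η * inner ℝ (N ω) (h (y ω, V ω)))
      (hN2.add (hin.const_mul _)) (hsq.const_mul _), integral_add hN2 (hin.const_mul _), integral_const_mul, integral_const_mul, hcross]
    nlinarith [mul_le_mul_of_nonneg_left hsq_le (sq_nonneg η)]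

/-! ### The path of one round -/

section Path

/-- The visits that come before visit number `j`. -/
def before (K j : ℕ) : Finset (Fin K) := Finset.univ.filter fun i => (i : ℕ) < j

theorem before_zero (K : ℕ) : before K 0 = ∅ := by simp [before]

theorem before_self (K : ℕ) : before K K = Finset.univ := by simp [before]

theorem mem_before {K j : ℕ} {i : Fin K} : i ∈ before K j ↔ (i : ℕ) < j := by simp [before]

theorem sum_before_succ {K : ℕ} {A : Type*} [AddCommMonoid A] (i : Fin K) (f : Fin K → A) :
    ∑ l ∈ before K (i + 1), f l = ∑ l ∈ before K i, f l + f i := by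
  have h : before K (i + 1) = insert i (before K i) := by
    ext l
    rw [Finset.mem_insert, mem_before, mem_before, Fin.ext_iff]
    omega
  rw [h, Finset.sum_insert (by simp [mem_before]), add_comm]

theorem sum_before_add_le {K : ℕ} (i : Fin K) {f : Fin K → ℝ} (hf : ∀ l, 0 ≤ f l) {a : ℝ}
    (ha : a ≤ f i) : ∑ l ∈ before K i, f l + a ≤ ∑ l, f l := by
  calc ∑ l ∈ before K i, f l + a ≤ ∑ l ∈ before K i, f l + f i := by gcongr
    _ = ∑ l ∈ before K (i + 1), f l := (sum_before_succ i f).symm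
    _ ≤ ∑ l, f l := Finset.sum_le_univ_sum_of_nonneg hf

/-- The share of the datasets that belong to group `k`. -/
noncomputable def groupWeight {M K : ℕ} (c : Fin M → Fin K) (k : Fin K) : ℝ := groupSize c k / M

theorem groupWeight_nonneg {M K : ℕ} (c : Fin M → Fin K) (k : Fin K) : 0 ≤ groupWeight c k := by
  unfold groupWeight
  positivity

theorem sum_groupWeight {M K : ℕ} (hM : 0 < M) (c : Fin M → Fin K) : ∑ k, groupWeight c k = 1 := by
  have hM' : (M : ℝ) ≠ 0 := by exact_mod_cast hM.ne'
  simp_rw [groupWeight]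
  rw [← Finset.sum_div, div_eq_one_iff_eq hM']
  exact_mod_cast sum_groupSize c

theorem groupStep_mul {M K : ℕ} (c : Fin M → Fin K) {S : Fin K → ℕ} (hS : ∀ k, 0 < S k) (γ : ℝ)
    (k : Fin K) (s : ℕ) :
    (s : ℝ) * groupStep c S γ k = γ * (((s : ℝ) / S k) * groupWeight c k) := by
  have hk : (S k : ℝ) ≠ 0 := by exact_mod_cast (hS k).ne'
  rw [groupStep, groupWeight]
  by_cases hM : (M : ℝ) = 0
  · simp [hM]
  · field_simp

theorem groupStep_nonneg {M K : ℕ} (c : Fin M → Fin K) (S : Fin K → ℕ) {γ : ℝ} (hγ : 0 ≤ γ)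
    (k : Fin K) : 0 ≤ groupStep c S γ k := by
  unfold groupStep
  positivity

variable {d M K : ℕ} {Ξ : Type*} (c : Fin M → Fin K) (g : Fin M → Param d → Ξ → Param d)
  (F : Fin M → Param d → ℝ) {S : Fin K → ℕ} (γ : ℝ) (w : RoundSeed M K S Ξ) (x : Param d)

/-- The parameter after `s` steps of visit number `i` of a round. -/
noncomputable def visitIterate (i : Fin K) (s : ℕ) : Param d :=
  localIterate (groupStep c S γ (w.1 i)) (groupGrad c g (w.1 i)) (w.2 (w.1 i))
    (roundIterate c g S γ w x i) s

/-- The sum of the exact gradient steps in the first `s` steps of visit number `i`. -/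
noncomputable def visitDrift (i : Fin K) (s : ℕ) : Param d :=
  ∑ t ∈ Finset.range s,
    groupStep c S γ (w.1 i) • gradient (groupLoss c F (w.1 i)) (visitIterate c g γ w x i t)

/-- The accumulated noise of the first `j` visits: the part of the displacement `x - Θ` which is
not due to exact gradient steps. -/
noncomputable def roundNoise (j : ℕ) : Param d :=
  x - roundIterate c g S γ w x j - ∑ i ∈ before K j, visitDrift c g F γ w x i (S (w.1 i))

/-- The accumulated noise up to step `s` of visit number `i`. -/
noncomputable def visitNoise (i : Fin K) (s : ℕ) : Param d :=
  x - visitIterate c g γ w x i s - ∑ l ∈ before K i, visitDrift c g F γ w x l (S (w.1 l)) -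
    visitDrift c g F γ w x i s

theorem roundIterate_succ (i : Fin K) :
    roundIterate c g S γ w x (i + 1) = visitIterate c g γ w x i (S (w.1 i)) := by
  rw [roundIterate, dif_pos i.2, visitIterate]

theorem visitIterate_zero (i : Fin K) :
    visitIterate c g γ w x i 0 = roundIterate c g S γ w x i := rfl

theorem visitIterate_succ (i : Fin K) (s : Fin (S (w.1 i))) :
    visitIterate c g γ w x i (s + 1) = visitIterate c g γ w x i s -
      groupStep c S γ (w.1 i) • groupGrad c g (w.1 i) (visitIterate c g γ w x i s)
        (w.2 (w.1 i) s) := by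
  rw [visitIterate, localIterate, dif_pos s.2]
  rfl

theorem roundNoise_zero : roundNoise c g F γ w x 0 = 0 := by
  simp [roundNoise, before_zero, roundIterate]

theorem visitNoise_zero (i : Fin K) : visitNoise c g F γ w x i 0 = roundNoise c g F γ w x i := by
  simp [visitNoise, roundNoise, visitDrift, visitIterate_zero]

theorem roundNoise_succ (i : Fin K) :
    roundNoise c g F γ w x (i + 1) = visitNoise c g F γ w x i (S (w.1 i)) := by
  rw [roundNoise, visitNoise, roundIterate_succ, sum_before_succ, sub_add_eq_sub_sub]

theorem visitNoise_succ (i : Fin K) (s : Fin (S (w.1 i))) :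
    visitNoise c g F γ w x i (s + 1) = visitNoise c g F γ w x i s +
      groupStep c S γ (w.1 i) •
        groupError c F g (w.1 i) (visitIterate c g γ w x i s) (w.2 (w.1 i) s) := by
  rw [visitNoise, visitNoise, visitDrift, visitDrift, Finset.sum_range_succ, visitIterate_succ,
    groupError, smul_sub]
  abel

/-- The weighted deviation of the gradient of group `k` from the overall gradient. -/
noncomputable def groupDeviation (k : Fin K) : Param d :=
  groupWeight c k • (gradient (groupLoss c F k) x - gradient (meanLoss F) x)

/-- The accumulated deviation of the group gradients at the start `x` of a round, up to step `s` of
visit number `i`. -/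
noncomputable def visitDeviation (S : Fin K → ℕ) (π : Equiv.Perm (Fin K)) (i : Fin K) (s : ℕ) :
    Param d :=
  ∑ l ∈ before K i, groupDeviation c F x (π l) + ((s : ℝ) / S (π i)) • groupDeviation c F x (π i)

variable {c F} {L : ℝ≥0}

theorem sum_groupDeviation (hM : 0 < M) (hc : Function.Surjective c)
    (hF : ∀ m, IsSmooth L (F m)) : ∑ k, groupDeviation c F x k = 0 := by
  simp_rw [groupDeviation, smul_sub]
  rw [Finset.sum_sub_distrib, ← Finset.sum_smul, sum_groupWeight hM, one_smul]
  exact sub_eq_zero.2 (sum_smul_gradient_groupLoss hc hF x)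

/-- The total distance from the start of the round, weighted by the step sizes. -/
noncomputable def totalDistance (c : Fin M → Fin K) : ℝ :=
  ∑ i, ∑ t ∈ Finset.range (S (w.1 i)), groupStep c S γ (w.1 i) * ‖visitIterate c g γ w x i t - x‖

/-- The change of the exact steps of a visit caused by leaving the start `x` of the round. -/
theorem norm_visitDrift_sub_le (hF : ∀ m, IsSmooth L (F m)) {γ : ℝ} (hγ : 0 ≤ γ) (i : Fin K)
    (s : ℕ) :
    ‖visitDrift c g F γ w x i s -
        ((s : ℝ) * groupStep c S γ (w.1 i)) • gradient (groupLoss c F (w.1 i)) x‖ ≤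
      L * ∑ t ∈ Finset.range s, groupStep c S γ (w.1 i) * ‖visitIterate c g γ w x i t - x‖ := by
  have h1 : ((s : ℝ) * groupStep c S γ (w.1 i)) • gradient (groupLoss c F (w.1 i)) x =
      ∑ t ∈ Finset.range s, groupStep c S γ (w.1 i) • gradient (groupLoss c F (w.1 i)) x := by
    rw [Finset.sum_const, Finset.card_range, mul_smul, Nat.cast_smul_eq_nsmul]
  rw [h1, visitDrift, ← Finset.sum_sub_distrib, Finset.mul_sum]
  refine (norm_sum_le _ _).trans (Finset.sum_le_sum fun t _ => ?_)
  have h0 := groupStep_nonneg c S hγ (w.1 i)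
  rw [← smul_sub, norm_smul, Real.norm_of_nonneg h0, ← dist_eq_norm, ← dist_eq_norm]
  calc groupStep c S γ (w.1 i) * _
      ≤ groupStep c S γ (w.1 i) * (L * dist (visitIterate c g γ w x i t) x) := by
        gcongr
        exact (isSmooth_groupLoss c hF (w.1 i)).2.dist_le_mul _ _
    _ = _ := by ring

theorem visitDrift_terms_nonneg {γ : ℝ} (hγ : 0 ≤ γ) (l : Fin K) :
    0 ≤ ∑ t ∈ Finset.range (S (w.1 l)),
      groupStep c S γ (w.1 l) * ‖visitIterate c g γ w x l t - x‖ :=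
  Finset.sum_nonneg fun _ _ => mul_nonneg (groupStep_nonneg c S hγ _) (norm_nonneg _)

theorem groupWeight_smul_gradient (k : Fin K) :
    groupWeight c k • gradient (groupLoss c F k) x =
      groupDeviation c F x k + groupWeight c k • gradient (meanLoss F) x := by
  rw [groupDeviation, smul_sub, sub_add_cancel]

/-- The distance from the start of the round consists of four parts: the change of the gradients
along the path, the deviation of the groups visited so far, the overall gradient, and the noise. -/
theorem norm_visitIterate_sub_le (hM : 0 < M) (hS : ∀ k, 0 < S k) (hF : ∀ m, IsSmooth L (F m))
    {γ : ℝ} (hγ : 0 ≤ γ) (i : Fin K) {s : ℕ} (hs : s ≤ S (w.1 i)) :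
    ‖visitIterate c g γ w x i s - x‖ ≤ L * totalDistance g γ w x c +
      (γ * ‖visitDeviation c F x S w.1 i s‖ + γ * ‖gradient (meanLoss F) x‖ +
        ‖visitNoise c g F γ w x i s‖) := by
  set q : ℝ := (s : ℝ) / S (w.1 i) with hq
  have hq0 : 0 ≤ q := by positivity
  have hq1 : q ≤ 1 := div_le_one_of_le₀ (by exact_mod_cast hs) (by positivity)
  have hfull : ∀ l, (S (w.1 l) : ℝ) * groupStep c S γ (w.1 l) = γ * groupWeight c (w.1 l) := by
    intro l
    have : (S (w.1 l) : ℝ) ≠ 0 := by exact_mod_cast (hS _).ne'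
    rw [groupStep_mul c hS, div_self this, one_mul]
  set a : Fin K → Param d := fun l => visitDrift c g F γ w x l (S (w.1 l)) -
    ((S (w.1 l) : ℝ) * groupStep c S γ (w.1 l)) • gradient (groupLoss c F (w.1 l)) x with ha
  set b : Param d := visitDrift c g F γ w x i s -
    ((s : ℝ) * groupStep c S γ (w.1 i)) • gradient (groupLoss c F (w.1 i)) x with hb
  set W : ℝ := ∑ l ∈ before K i, groupWeight c (w.1 l) + q * groupWeight c (w.1 i) with hW
  have hdecomp : x - visitIterate c g γ w x i s = (∑ l ∈ before K i, a l + b) +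
      γ • visitDeviation c F x S w.1 i s + (γ * W) • gradient (meanLoss F) x +
      visitNoise c g F γ w x i s := by
    have h1 : γ • visitDeviation c F x S w.1 i s + (γ * W) • gradient (meanLoss F) x =
        ∑ l ∈ before K i, ((S (w.1 l) : ℝ) * groupStep c S γ (w.1 l)) •
          gradient (groupLoss c F (w.1 l)) x +
        ((s : ℝ) * groupStep c S γ (w.1 i)) • gradient (groupLoss c F (w.1 i)) x := by
      simp_rw [hfull, groupStep_mul c hS, mul_smul, groupWeight_smul_gradient]
      rw [visitDeviation, hW, ← hq, ← Finset.smul_sum, Finset.sum_add_distrib, ← Finset.sum_smul,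
        ← smul_add, ← smul_add]
      congr 1
      rw [add_smul, smul_add, mul_smul]
      abel
    rw [add_assoc (∑ l ∈ before K i, a l + b), h1, visitNoise, ha, hb, Finset.sum_sub_distrib]
    abel
  have h1 : ‖∑ l ∈ before K i, a l + b‖ ≤ L * totalDistance g γ w x c := by
    calc ‖∑ l ∈ before K i, a l + b‖ ≤ ∑ l ∈ before K i, ‖a l‖ + ‖b‖ :=
          (norm_add_le _ _).trans (by gcongr; exact norm_sum_le _ _)
      _ ≤ ∑ l ∈ before K i, L * ∑ t ∈ Finset.range (S (w.1 l)),
            groupStep c S γ (w.1 l) * ‖visitIterate c g γ w x l t - x‖ +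
          L * ∑ t ∈ Finset.range s,
            groupStep c S γ (w.1 i) * ‖visitIterate c g γ w x i t - x‖ := by
          gcongr with l
          · exact norm_visitDrift_sub_le g w x hF hγ l _
          · exact norm_visitDrift_sub_le g w x hF hγ i s
      _ = L * (∑ l ∈ before K i, ∑ t ∈ Finset.range (S (w.1 l)),
            groupStep c S γ (w.1 l) * ‖visitIterate c g γ w x l t - x‖ +
          ∑ t ∈ Finset.range s,
            groupStep c S γ (w.1 i) * ‖visitIterate c g γ w x i t - x‖) := by
          rw [mul_add, Finset.mul_sum (before K i)]
      _ ≤ L * totalDistance g γ w x c := by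
          gcongr
          refine sum_before_add_le i (fun l => visitDrift_terms_nonneg g w x hγ l) ?_
          refine Finset.sum_le_sum_of_subset_of_nonneg (Finset.range_subset_range.2 hs)
            fun _ _ _ => mul_nonneg (groupStep_nonneg c S hγ _) (norm_nonneg _)
  have hW0 : 0 ≤ W := add_nonneg (Finset.sum_nonneg fun _ _ => groupWeight_nonneg _ _)
    (mul_nonneg hq0 (groupWeight_nonneg _ _))
  have hW1 : W ≤ 1 := by
    refine (sum_before_add_le i (fun l => groupWeight_nonneg c (w.1 l))
      (mul_le_of_le_one_left (groupWeight_nonneg _ _) hq1)).trans_eq ?_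
    rw [Equiv.sum_comp w.1 (groupWeight c), sum_groupWeight hM]
  rw [norm_sub_rev, hdecomp]
  refine (norm_add₃_le.trans ?_)
  have h2 := norm_add_le (∑ l ∈ before K i, a l + b) (γ • visitDeviation c F x S w.1 i s)
  have h3 : ‖γ • visitDeviation c F x S w.1 i s‖ = γ * ‖visitDeviation c F x S w.1 i s‖ := by
    rw [norm_smul, Real.norm_of_nonneg hγ]
  have h4 : ‖(γ * W) • gradient (meanLoss F) x‖ ≤ γ * ‖gradient (meanLoss F) x‖ := by
    rw [norm_smul, Real.norm_of_nonneg (by positivity)]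
    gcongr
    exact mul_le_of_le_one_right hγ hW1
  linarith

/-- A self-bounding weighted average: if each `e i` exceeds `b i` by at most `L` times the weighted
sum of all `e`, and the weights add up to at most `1 / (2 L)`, then the sum is controlled by `b`. -/
theorem sq_sum_mul_le_of_le {ι : Type*} (s : Finset ι) {p e b : ι → ℝ} {L γ : ℝ}
    (hp : ∀ i ∈ s, 0 ≤ p i) (he : ∀ i ∈ s, 0 ≤ e i) (hsum : ∑ i ∈ s, p i = γ)
    (hγL : 2 * L * γ ≤ 1) (h : ∀ i ∈ s, e i ≤ L * ∑ j ∈ s, p j * e j + b i) :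
    (∑ i ∈ s, p i * e i) ^ 2 ≤ 4 * γ * ∑ i ∈ s, p i * b i ^ 2 := by
  set T := ∑ i ∈ s, p i * e i with hT
  have hT0 : 0 ≤ T := Finset.sum_nonneg fun i hi => mul_nonneg (hp i hi) (he i hi)
  have h1 : T ≤ γ * (L * T) + ∑ i ∈ s, p i * b i := by
    rw [← hsum, Finset.sum_mul, ← Finset.sum_add_distrib]
    refine Finset.sum_le_sum fun i hi => ?_
    rw [← mul_add]
    exact mul_le_mul_of_nonneg_left (h i hi) (hp i hi)
  have h2 : T ≤ 2 * ∑ i ∈ s, p i * b i := by nlinarith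
  have h3 : (∑ i ∈ s, p i * b i) ^ 2 ≤ γ * ∑ i ∈ s, p i * b i ^ 2 := by
    rw [← hsum]
    exact Finset.sum_sq_le_sum_mul_sum_of_sq_le_mul s hp
      (fun i hi => mul_nonneg (hp i hi) (sq_nonneg _)) fun i _ => (by ring : _ = _).le
  calc T ^ 2 ≤ (2 * ∑ i ∈ s, p i * b i) ^ 2 := by gcongr
    _ = 4 * (∑ i ∈ s, p i * b i) ^ 2 := by ring
    _ ≤ 4 * (γ * ∑ i ∈ s, p i * b i ^ 2) := by gcongr
    _ = _ := by ring

/-- The weighted sum of the squared perturbations that drive the iterates of a round away from its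
start. -/
noncomputable def perturbation (c : Fin M → Fin K) (F : Fin M → Param d → ℝ) : ℝ :=
  ∑ i, ∑ t ∈ Finset.range (S (w.1 i)), groupStep c S γ (w.1 i) *
    (γ ^ 2 * ‖visitDeviation c F x S w.1 i t‖ ^ 2 + γ ^ 2 * ‖gradient (meanLoss F) x‖ ^ 2 +
      ‖visitNoise c g F γ w x i t‖ ^ 2)

theorem sum_sum_groupStep (hM : 0 < M) (hS : ∀ k, 0 < S k) (π : Equiv.Perm (Fin K)) :
    ∑ i, ∑ _t ∈ Finset.range (S (π i)), groupStep c S γ (π i) = γ := by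
  have hfull : ∀ i, ∑ _t ∈ Finset.range (S (π i)), groupStep c S γ (π i) =
      γ * groupWeight c (π i) := by
    intro i
    have : (S (π i) : ℝ) ≠ 0 := by exact_mod_cast (hS _).ne'
    rw [Finset.sum_const, Finset.card_range, nsmul_eq_mul, groupStep_mul c hS, div_self this,
      one_mul]
  simp_rw [hfull]
  rw [← Finset.mul_sum, Equiv.sum_comp π (groupWeight c), sum_groupWeight hM, mul_one]

theorem sq_totalDistance_le (hM : 0 < M) (hS : ∀ k, 0 < S k) (hF : ∀ m, IsSmooth L (F m))
    {γ : ℝ} (hγ : 0 ≤ γ) (hγL : 2 * L * γ ≤ 1) :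
    totalDistance g γ w x c ^ 2 ≤ 12 * γ * perturbation g γ w x c F := by
  have h := sq_sum_mul_le_of_le
    ((Finset.univ : Finset (Fin K)).sigma fun i => Finset.range (S (w.1 i)))
    (p := fun q => groupStep c S γ (w.1 q.1)) (e := fun q => ‖visitIterate c g γ w x q.1 q.2 - x‖)
    (b := fun q => γ * ‖visitDeviation c F x S w.1 q.1 q.2‖ + γ * ‖gradient (meanLoss F) x‖ +
        ‖visitNoise c g F γ w x q.1 q.2‖) (L := L) (γ := γ)
    (fun q _ => groupStep_nonneg c S hγ _) (fun q _ => norm_nonneg _)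
    (by rw [Finset.sum_sigma]; exact sum_sum_groupStep γ hM hS w.1) hγL
    (fun q hq => by
      rw [Finset.sum_sigma]
      rw [Finset.mem_sigma, Finset.mem_range] at hq
      exact norm_visitIterate_sub_le g w x hM hS hF hγ q.1 hq.2.le)
  rw [Finset.sum_sigma, Finset.sum_sigma] at h
  refine h.trans ?_
  rw [perturbation, show 12 * γ = 4 * γ * 3 by ring, mul_assoc (4 * γ) 3]
  refine mul_le_mul_of_nonneg_left ?_ (by positivity)
  rw [Finset.mul_sum]
  refine Finset.sum_le_sum fun i _ => ?_
  rw [Finset.mul_sum]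
  refine Finset.sum_le_sum fun t _ => ?_
  have h0 := groupStep_nonneg c S hγ (w.1 i)
  set u := γ * ‖visitDeviation c F x S w.1 i t‖
  set v := γ * ‖gradient (meanLoss F) x‖
  set n := ‖visitNoise c g F γ w x i t‖
  have h1 : (u + v + n) ^ 2 ≤ 3 * (u ^ 2 + v ^ 2 + n ^ 2) := by
    nlinarith [sq_nonneg (u - v), sq_nonneg (u - n), sq_nonneg (v - n)]
  calc groupStep c S γ (w.1 i) * (u + v + n) ^ 2
      ≤ groupStep c S γ (w.1 i) * (3 * (u ^ 2 + v ^ 2 + n ^ 2)) := by gcongr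
    _ = _ := by ring

/-- A round is a gradient step with step size `γ` up to its noise and an error caused by moving away
from the start of the round. -/
theorem norm_sq_round_error_le (hM : 0 < M) (hc : Function.Surjective c) (hS : ∀ k, 0 < S k)
    (hF : ∀ m, IsSmooth L (F m)) {γ : ℝ} (hγ : 0 ≤ γ) (hγL : 2 * L * γ ≤ 1) :
    ‖x - roundIterate c g S γ w x K - roundNoise c g F γ w x K -
        γ • gradient (meanLoss F) x‖ ^ 2 ≤ 12 * L ^ 2 * γ * perturbation g γ w x c F := by
  have hfull : ∀ l, (S (w.1 l) : ℝ) * groupStep c S γ (w.1 l) = γ * groupWeight c (w.1 l) := by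
    intro l
    have : (S (w.1 l) : ℝ) ≠ 0 := by exact_mod_cast (hS _).ne'
    rw [groupStep_mul c hS, div_self this, one_mul]
  have h1 : γ • gradient (meanLoss F) x =
      ∑ l, ((S (w.1 l) : ℝ) * groupStep c S γ (w.1 l)) • gradient (groupLoss c F (w.1 l)) x := by
    simp_rw [hfull, mul_smul]
    rw [← Finset.smul_sum,
      Equiv.sum_comp w.1 fun k => groupWeight c k • gradient (groupLoss c F k) x]
    congr 1
    exact (sum_smul_gradient_groupLoss hc hF x).symm
  have h2 : x - roundIterate c g S γ w x K - roundNoise c g F γ w x K -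
      γ • gradient (meanLoss F) x = ∑ l, (visitDrift c g F γ w x l (S (w.1 l)) -
        ((S (w.1 l) : ℝ) * groupStep c S γ (w.1 l)) • gradient (groupLoss c F (w.1 l)) x) := by
    rw [h1, roundNoise, before_self, Finset.sum_sub_distrib]
    abel
  have h3 : ‖x - roundIterate c g S γ w x K - roundNoise c g F γ w x K -
      γ • gradient (meanLoss F) x‖ ≤ L * totalDistance g γ w x c := by
    rw [h2, totalDistance, Finset.mul_sum]
    exact (norm_sum_le _ _).trans
      (Finset.sum_le_sum fun l _ => norm_visitDrift_sub_le g w x hF hγ l _)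
  calc _ ≤ (L * totalDistance g γ w x c) ^ 2 := by gcongr
    _ = L ^ 2 * totalDistance g γ w x c ^ 2 := by ring
    _ ≤ L ^ 2 * (12 * γ * perturbation g γ w x c F) := by
        gcongr
        exact sq_totalDistance_le g w x hM hS hF hγ hγL
    _ = _ := by ring

/-- The decrease of the loss in one round, before taking expectations. -/
theorem meanLoss_roundIterate_le (hM : 0 < M) (hc : Function.Surjective c) (hS : ∀ k, 0 < S k)
    (hF : ∀ m, IsSmooth L (F m)) {γ : ℝ} (hγ : 0 < γ) (hγL : 12 * L * γ ≤ 1) :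
    meanLoss F (roundIterate c g S γ w x K) ≤ meanLoss F x -
      γ / 2 * ‖gradient (meanLoss F) x‖ ^ 2 -
      inner ℝ (gradient (meanLoss F) x) (roundNoise c g F γ w x K) +
      24 * L ^ 2 * perturbation g γ w x c F + 3 * L * ‖roundNoise c g F γ w x K‖ ^ 2 := by
  have hL0 : (0 : ℝ) ≤ L := L.2
  have herr := norm_sq_round_error_le g w x hM hc hS hF hγ.le (by nlinarith)
  set N := roundNoise c g F γ w x K
  set G := gradient (meanLoss F) x
  set y := roundIterate c g S γ w x K
  set B := perturbation g γ w x c F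
  set e := x - y - N - γ • G with he
  have hy : y - x = -(γ • G + e + N) := by rw [he]; abel
  have hdesc := (abs_le.1 (abs_sub_sub_inner_gradient_le (isSmooth_meanLoss hF) x y)).2
  have hin : inner ℝ G (y - x) = -(γ * ‖G‖ ^ 2) - inner ℝ G e - inner ℝ G N := by
    rw [hy, inner_neg_right, inner_add_right, inner_add_right, inner_smul_right,
      real_inner_self_eq_norm_sq]
    ring
  have hsq : ‖y - x‖ ^ 2 ≤ 3 * (γ ^ 2 * ‖G‖ ^ 2 + ‖e‖ ^ 2 + ‖N‖ ^ 2) := by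
    rw [hy, norm_neg]
    have h1 : ‖γ • G + e + N‖ ≤ γ * ‖G‖ + ‖e‖ + ‖N‖ := by
      refine norm_add₃_le.trans_eq ?_
      rw [norm_smul, Real.norm_of_nonneg hγ.le]
    have h2 := pow_le_pow_left₀ (norm_nonneg _) h1 2
    nlinarith [sq_nonneg (γ * ‖G‖ - ‖e‖), sq_nonneg (γ * ‖G‖ - ‖N‖), sq_nonneg (‖e‖ - ‖N‖)]
  have hyoung : -inner ℝ G e ≤ γ / 4 * ‖G‖ ^ 2 + 1 / γ * ‖e‖ ^ 2 := by
    have h1 : -inner ℝ G e ≤ ‖G‖ * ‖e‖ := (neg_le_abs _).trans (abs_real_inner_le_norm G e)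
    have h2 : γ / 4 * ‖G‖ ^ 2 + 1 / γ * ‖e‖ ^ 2 - ‖G‖ * ‖e‖ =
        1 / γ * (γ / 2 * ‖G‖ - ‖e‖) ^ 2 := by
      field_simp
      ring
    have h3 : 0 ≤ 1 / γ * (γ / 2 * ‖G‖ - ‖e‖) ^ 2 := by positivity
    linarith
  have h1 : L * ‖y - x‖ ^ 2 ≤ L * (3 * (γ ^ 2 * ‖G‖ ^ 2 + ‖e‖ ^ 2 + ‖N‖ ^ 2)) := by gcongr
  have h2 : 3 * L * γ ^ 2 * ‖G‖ ^ 2 ≤ γ / 4 * ‖G‖ ^ 2 := by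
    gcongr
    nlinarith
  have h3 : 3 * L * ‖e‖ ^ 2 ≤ 1 / γ * ‖e‖ ^ 2 := by
    gcongr
    rw [le_div_iff₀ hγ]
    nlinarith [mul_nonneg hL0 hγ.le]
  have h4 : 2 / γ * ‖e‖ ^ 2 ≤ 24 * L ^ 2 * B := by
    calc 2 / γ * ‖e‖ ^ 2 ≤ 2 / γ * (12 * L ^ 2 * γ * B) := by gcongr
      _ = 24 * L ^ 2 * B := by field_simp; ring
  have h5 : 2 / γ * ‖e‖ ^ 2 = 1 / γ * ‖e‖ ^ 2 + 1 / γ * ‖e‖ ^ 2 := by ring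
  nlinarith

theorem norm_sq_roundIterate_sub_le (hM : 0 < M) (hc : Function.Surjective c)
    (hS : ∀ k, 0 < S k) (hF : ∀ m, IsSmooth L (F m)) {γ : ℝ} (hγ : 0 < γ)
    (hγL : 12 * L * γ ≤ 1) :
    ‖roundIterate c g S γ w x K - x‖ ^ 2 ≤ 3 * (γ ^ 2 * ‖gradient (meanLoss F) x‖ ^ 2 +
      12 * L ^ 2 * γ * perturbation g γ w x c F + ‖roundNoise c g F γ w x K‖ ^ 2) := by
  have hL0 : (0 : ℝ) ≤ L := L.2
  have herr := norm_sq_round_error_le g w x hM hc hS hF hγ.le (by nlinarith)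
  set N := roundNoise c g F γ w x K
  set G := gradient (meanLoss F) x
  set y := roundIterate c g S γ w x K
  set e := x - y - N - γ • G with he
  have hy : y - x = -(γ • G + e + N) := by rw [he]; abel
  have h1 : ‖y - x‖ ≤ γ * ‖G‖ + ‖e‖ + ‖N‖ := by
    rw [hy, norm_neg]
    refine norm_add₃_le.trans_eq ?_
    rw [norm_smul, Real.norm_of_nonneg hγ.le]
  have h2 := pow_le_pow_left₀ (norm_nonneg _) h1 2
  nlinarith [sq_nonneg (γ * ‖G‖ - ‖e‖), sq_nonneg (γ * ‖G‖ - ‖N‖), sq_nonneg (‖e‖ - ‖N‖)]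

end Path

/-! ### The noise of one round -/

section Congruence

variable {d M K : ℕ} {Ξ : Type*} {c : Fin M → Fin K} {g : Fin M → Param d → Ξ → Param d}
  {F : Fin M → Param d → ℝ} {S : Fin K → ℕ} {γ : ℝ} {π : Equiv.Perm (Fin K)}
  {z z' : (k : Fin K) → Fin (S k) → Fin M → Ξ} {x : Param d}

theorem localIterate_congr {n : ℕ} {Z : Type*} {η : ℝ} {h : Param d → Z → Param d}
    {u v : Fin n → Z} {s : ℕ} (huv : ∀ t : Fin n, (t : ℕ) < s → u t = v t) :
    localIterate η h u x s = localIterate η h v x s := by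
  induction s with
  | zero => rfl
  | succ s ih =>
    simp only [localIterate]
    rw [ih fun t ht => huv t (by omega)]
    split_ifs with hs
    · rw [huv ⟨s, hs⟩ (Nat.lt_succ_self s)]
    · rfl

theorem roundIterate_congr {j : ℕ} (h : ∀ l : Fin K, (l : ℕ) < j → z (π l) = z' (π l)) :
    roundIterate c g S γ (π, z) x j = roundIterate c g S γ (π, z') x j := by
  induction j with
  | zero => rfl
  | succ j ih =>
    simp only [roundIterate]
    rw [ih fun l hl => h l (by omega)]
    split_ifs with hj
    · rw [h ⟨j, hj⟩ (Nat.lt_succ_self j)]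
    · rfl

theorem visitIterate_congr {i : Fin K} {s : ℕ}
    (h : ∀ l : Fin K, (l : ℕ) < i → z (π l) = z' (π l))
    (hs : ∀ t : Fin (S (π i)), (t : ℕ) < s → z (π i) t = z' (π i) t) :
    visitIterate c g γ (π, z) x i s = visitIterate c g γ (π, z') x i s := by
  rw [visitIterate, visitIterate, roundIterate_congr h]
  exact localIterate_congr hs

theorem visitNoise_congr {i : Fin K} {s : ℕ}
    (h : ∀ l : Fin K, (l : ℕ) < i → z (π l) = z' (π l))
    (hs : ∀ t : Fin (S (π i)), (t : ℕ) < s → z (π i) t = z' (π i) t) :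
    visitNoise c g F γ (π, z) x i s = visitNoise c g F γ (π, z') x i s := by
  have h1 : ∀ l ∈ before K i, visitDrift c g F γ (π, z) x l (S (π l)) =
      visitDrift c g F γ (π, z') x l (S (π l)) := by
    intro l hl
    rw [mem_before] at hl
    refine Finset.sum_congr rfl fun t _ => ?_
    rw [visitIterate_congr (fun m hm => h m (hm.trans hl)) fun t _ => congrFun (h l hl) t]
  have h2 : visitDrift c g F γ (π, z) x i s = visitDrift c g F γ (π, z') x i s := by
    refine Finset.sum_congr rfl fun t ht => ?_
    rw [Finset.mem_range] at ht
    rw [visitIterate_congr h fun t' ht' => hs t' (ht'.trans ht)]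
  simp only [visitNoise]
  rw [visitIterate_congr h hs, h2, Finset.sum_congr rfl h1]

end Congruence

section Measurability

variable {d M K : ℕ} {Ξ : Type*} [MeasurableSpace Ξ] {L : ℝ≥0} {F : Fin M → Param d → ℝ}
  {c : Fin M → Fin K} {P : Fin M → Measure Ξ} {g : Fin M → Param d → Ξ → Param d} {σ : ℝ}
  {S : Fin K → ℕ} {γ : ℝ} {α : Type*} [MeasurableSpace α]

theorem measurable_localIterate {n : ℕ} {Z : Type*} [MeasurableSpace Z] {η : ℝ}
    {h : Param d → Z → Param d} (hh : Measurable fun p : Param d × Z => h p.1 p.2)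
    {u : α → Fin n → Z} (hu : Measurable u) {y : α → Param d} (hy : Measurable y) (s : ℕ) :
    Measurable fun a => localIterate η h (u a) (y a) s := by
  induction s with
  | zero => exact hy
  | succ s ih =>
    simp only [localIterate]
    split_ifs with hs
    · have h1 : Measurable fun a => h (localIterate η h (u a) (y a) s) (u a ⟨s, hs⟩) :=
        hh.comp (ih.prodMk ((measurable_pi_apply _).comp hu))
      exact ih.sub (h1.const_smul η)
    · exact ih

theorem measurable_roundIterate (hg : IsStochasticGradient F P g σ) (π : Equiv.Perm (Fin K))
    {z : α → (k : Fin K) → Fin (S k) → Fin M → Ξ} (hz : Measurable z) {y : α → Param d}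
    (hy : Measurable y) (j : ℕ) :
    Measurable fun a => roundIterate c g S γ (π, z a) (y a) j := by
  induction j with
  | zero => exact hy
  | succ j ih =>
    simp only [roundIterate]
    split_ifs with hj
    · exact measurable_localIterate (measurable_groupGrad hg _)
        ((measurable_pi_apply _).comp hz) ih _
    · exact ih

variable (x : Param d) (π : Equiv.Perm (Fin K))

theorem measurable_visitIterate (hg : IsStochasticGradient F P g σ) (i : Fin K) (s : ℕ) :
    Measurable fun z : (k : Fin K) → Fin (S k) → Fin M → Ξ =>
      visitIterate c g γ (π, z) x i s := by
  simp only [visitIterate]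
  exact measurable_localIterate (measurable_groupGrad hg _) (measurable_pi_apply (π i))
    (measurable_roundIterate hg π measurable_id measurable_const i) s

theorem measurable_visitDrift (hF : ∀ m, IsSmooth L (F m)) (hg : IsStochasticGradient F P g σ)
    (i : Fin K) (s : ℕ) :
    Measurable fun z : (k : Fin K) → Fin (S k) → Fin M → Ξ =>
      visitDrift c g F γ (π, z) x i s :=
  Finset.measurable_fun_sum _ fun t _ =>
    (((isSmooth_groupLoss c hF (π i)).measurable_gradient).comp
      (measurable_visitIterate x π hg i t)).const_smul (groupStep c S γ (π i))

theorem measurable_visitNoise (hF : ∀ m, IsSmooth L (F m)) (hg : IsStochasticGradient F P g σ)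
    (i : Fin K) (s : ℕ) :
    Measurable fun z : (k : Fin K) → Fin (S k) → Fin M → Ξ =>
      visitNoise c g F γ (π, z) x i s := by
  have h1 : Measurable fun z : (k : Fin K) → Fin (S k) → Fin M → Ξ =>
      ∑ l ∈ before K i, visitDrift c g F γ (π, z) x l (S (π l)) :=
    Finset.measurable_fun_sum _ fun l _ => measurable_visitDrift x π hF hg l (S (π l))
  have h2 := measurable_visitIterate (c := c) (S := S) (γ := γ) x π hg i s
  have h3 := measurable_visitDrift (c := c) (S := S) (γ := γ) x π hF hg i s
  exact ((measurable_const.sub h2).sub h1).sub h3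

end Measurability

section Moments

variable {d M K : ℕ} {Ξ : Type*} [MeasurableSpace Ξ] {L : ℝ≥0} {F : Fin M → Param d → ℝ}
  {c : Fin M → Fin K} {P : Fin M → Measure Ξ} [∀ m, IsProbabilityMeasure (P m)]
  {g : Fin M → Param d → Ξ → Param d} {σ : ℝ} (S : Fin K → ℕ) (γ : ℝ)

/-- The law of the samples of one round. -/
noncomputable def sampleLaw (P : Fin M → Measure Ξ) :
    Measure ((k : Fin K) → Fin (S k) → Fin M → Ξ) :=
  Measure.pi fun k => Measure.pi fun _ : Fin (S k) => Measure.pi P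

instance : IsProbabilityMeasure (sampleLaw S P) := by
  unfold sampleLaw
  infer_instance

/-- Redrawing the samples of one step preserves the law of the samples of a round. -/
theorem measurePreserving_update_update (k : Fin K) (t : Fin (S k)) :
    MeasurePreserving
      (fun p : ((k : Fin K) → Fin (S k) → Fin M → Ξ) × (Fin M → Ξ) =>
        Function.update p.1 k (Function.update (p.1 k) t p.2))
      ((sampleLaw S P).prod (Measure.pi P)) (sampleLaw S P) :=
  measurePreserving_update (fun k => Measure.pi fun _ : Fin (S k) => Measure.pi P) (Measure.pi P) k
    (measurePreserving_update_snd (fun _ : Fin (S k) => Measure.pi P) t)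

variable {S} (x : Param d) (π : Equiv.Perm (Fin K))

/-- What has happened before step `s` of visit number `i` is independent of the samples of that
step. -/
theorem indepFun_visit (hF : ∀ m, IsSmooth L (F m)) (hg : IsStochasticGradient F P g σ)
    (i : Fin K) (s : Fin (S (π i))) :
    (fun z : (k : Fin K) → Fin (S k) → Fin M → Ξ =>
      (visitNoise c g F γ (π, z) x i s, visitIterate c g γ (π, z) x i s))
      ⟂ᵢ[sampleLaw S P] (fun z => z (π i) s) ∧
    (sampleLaw S P).map (fun z => z (π i) s) = Measure.pi P := by
  refine indepFun_of_measurePreserving (measurePreserving_update_update S (π i) s)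
    ((measurable_visitNoise x π hF hg i s).prodMk (measurable_visitIterate x π hg i s))
    ((measurable_pi_apply s).comp (measurable_pi_apply (π i))) (fun z v => ?_) (fun z v => ?_)
  · have h1 : ∀ l : Fin K, (l : ℕ) < i →
        Function.update z (π i) (Function.update (z (π i)) s v) (π l) = z (π l) := by
      intro l hl
      refine Function.update_of_ne (fun h => ?_) _ _
      rw [π.injective h] at hl
      exact lt_irrefl _ hl
    have h2 : ∀ t : Fin (S (π i)), (t : ℕ) < s →
        Function.update z (π i) (Function.update (z (π i)) s v) (π i) t = z (π i) t := by
      intro t ht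
      rw [Function.update_self]
      refine Function.update_of_ne (fun h => ?_) _ _
      rw [h] at ht
      exact lt_irrefl _ ht
    exact Prod.ext (visitNoise_congr h1 h2) (visitIterate_congr h1 h2)
  · simp

/-- The random vector `X` is centred and has second moment at most `v`. -/
structure IsCentredWithin {Ω : Type*} [MeasurableSpace Ω] (μ : Measure Ω) (X : Ω → Param d)
    (v : ℝ) : Prop where
  memLp : MemLp X 2 μ
  mean : ∫ a, X a ∂μ = 0
  sq_le : ∫ a, ‖X a‖ ^ 2 ∂μ ≤ v

theorem isCentredWithin_visitNoise_of_roundNoise (hc : Function.Surjective c)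
    (hF : ∀ m, IsSmooth L (F m)) (hg : IsStochasticGradient F P g σ) (i : Fin K) {v : ℝ}
    (h : IsCentredWithin (sampleLaw S P) (fun z => roundNoise c g F γ (π, z) x i) v) {s : ℕ}
    (hs : s ≤ S (π i)) :
    IsCentredWithin (sampleLaw S P) (fun z => visitNoise c g F γ (π, z) x i s)
      (v + s * (groupStep c S γ (π i) ^ 2 * groupNoise c F P g ^ 2)) := by
  induction s with
  | zero => simpa [visitNoise_zero] using h
  | succ s ih =>
    have hs' : s < S (π i) := hs
    specialize ih hs'.le
    obtain ⟨hind, hlaw⟩ := indepFun_visit γ x π hF hg (P := P) (c := c) i ⟨s, hs'⟩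
    obtain ⟨h1, h2, h3⟩ := moments_add_smul_of_indepFun (η := groupStep c S γ (π i))
      (h := fun p => groupError c F g (π i) p.1 p.2) (measurable_visitIterate x π hg i s)
      (measurable_visitNoise x π hF hg i s)
      ((measurable_pi_apply (⟨s, hs'⟩ : Fin (S (π i)))).comp (measurable_pi_apply (π i)))
      hind hlaw ih.memLp (measurable_groupError hF hg (π i)) (memLp_groupError hF hg (π i))
      (integral_groupError hF hg (π i)) (integral_groupError_sq_le hc hF hg (π i))
    have hstep : ∀ z : (k : Fin K) → Fin (S k) → Fin M → Ξ,
        visitNoise c g F γ (π, z) x i (s + 1) = visitNoise c g F γ (π, z) x i s +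
        groupStep c S γ (π i) •
          groupError c F g (π i) (visitIterate c g γ (π, z) x i s) (z (π i) ⟨s, hs'⟩) :=
      fun z => visitNoise_succ c g F γ (π, z) x i ⟨s, hs'⟩
    simp_rw [hstep]
    refine ⟨h1, h2.trans ih.mean, h3.trans ?_⟩
    push_cast
    linarith [ih.sq_le]

theorem isCentredWithin_roundNoise (hc : Function.Surjective c) (hF : ∀ m, IsSmooth L (F m))
    (hg : IsStochasticGradient F P g σ) {j : ℕ} (hj : j ≤ K) :
    IsCentredWithin (sampleLaw S P) (fun z => roundNoise c g F γ (π, z) x j)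
      (∑ i ∈ before K j, S (π i) * (groupStep c S γ (π i) ^ 2 * groupNoise c F P g ^ 2)) := by
  induction j with
  | zero =>
    simp_rw [roundNoise_zero]
    exact ⟨MemLp.zero, by simp, by simp [before_zero]⟩
  | succ j ih =>
    have h1 := isCentredWithin_visitNoise_of_roundNoise γ x π hc hF hg ⟨j, hj⟩
      (ih (Nat.le_of_succ_le hj)) le_rfl
    have h2 : ∀ z : (k : Fin K) → Fin (S k) → Fin M → Ξ,
        roundNoise c g F γ (π, z) x (j + 1) = _ :=
      fun z => roundNoise_succ c g F γ (π, z) x ⟨j, hj⟩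
    simp_rw [h2]
    rwa [← sum_before_succ (⟨j, hj⟩ : Fin K)
      fun i => (S (π i) : ℝ) * (groupStep c S γ (π i) ^ 2 * groupNoise c F P g ^ 2)] at h1

theorem groupWeight_le {ρ : ℝ} (hM : 0 < M)
    (hρ : ∀ k, (K : ℝ) * (groupSize c k : ℝ) ≤ ρ * (M : ℝ)) (k : Fin K) :
    groupWeight c k ≤ ρ / K := by
  have hM' : (0 : ℝ) < M := by exact_mod_cast hM
  have hK : (0 : ℝ) < K := by exact_mod_cast Fin.pos k
  rw [groupWeight, div_le_div_iff₀ hM' hK, mul_comm]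
  exact hρ k

theorem sum_groupStep_sq_le {ρ : ℝ} (hM : 0 < M)
    (hS : ∀ k, 0 < S k) (hρ : ∀ k, (K : ℝ) * (groupSize c k : ℝ) ≤ ρ * (M : ℝ)) :
    ∑ i, S (π i) * groupStep c S γ (π i) ^ 2 ≤ γ ^ 2 * ρ / K := by
  have h1 : ∀ k, S k * groupStep c S γ k ^ 2 ≤ γ ^ 2 * (groupWeight c k * (ρ / K)) := by
    intro k
    have hk : (1 : ℝ) ≤ S k := by exact_mod_cast hS k
    have hk0 : (S k : ℝ) ≠ 0 := by positivity
    have h2 : (S k : ℝ) * groupStep c S γ k = γ * groupWeight c k := by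
      rw [groupStep_mul c hS, div_self hk0, one_mul]
    have hw := groupWeight_nonneg c k
    calc (S k : ℝ) * groupStep c S γ k ^ 2 ≤ (S k : ℝ) * ((S k : ℝ) * groupStep c S γ k ^ 2) :=
          le_mul_of_one_le_left (by positivity) hk
      _ = (S k * groupStep c S γ k) ^ 2 := by ring
      _ = γ ^ 2 * (groupWeight c k * groupWeight c k) := by rw [h2]; ring
      _ ≤ _ := by
          gcongr
          exact groupWeight_le hM hρ k
  calc ∑ i, S (π i) * groupStep c S γ (π i) ^ 2
      ≤ ∑ i, γ ^ 2 * (groupWeight c (π i) * (ρ / K)) := Finset.sum_le_sum fun i _ => h1 (π i)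
    _ = γ ^ 2 * ρ / K := by
        rw [← Finset.mul_sum, ← Finset.sum_mul, Equiv.sum_comp π (groupWeight c),
          sum_groupWeight hM]
        ring

/-- The noise accumulated at any time of a round has variance at most `γ² ρ σ_g² / K`. -/
theorem isCentredWithin_visitNoise {ρ : ℝ} (hM : 0 < M) (hc : Function.Surjective c)
    (hS : ∀ k, 0 < S k) (hρ : ∀ k, (K : ℝ) * (groupSize c k : ℝ) ≤ ρ * (M : ℝ))
    (hF : ∀ m, IsSmooth L (F m)) (hg : IsStochasticGradient F P g σ) (i : Fin K) {s : ℕ}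
    (hs : s ≤ S (π i)) :
    IsCentredWithin (sampleLaw S P) (fun z => visitNoise c g F γ (π, z) x i s)
      (γ ^ 2 * ρ / K * groupNoise c F P g ^ 2) := by
  have h1 := isCentredWithin_visitNoise_of_roundNoise γ x π hc hF hg i
    (isCentredWithin_roundNoise γ x π hc hF hg i.2.le) hs
  refine ⟨h1.memLp, h1.mean, h1.sq_le.trans ?_⟩
  refine (sum_before_add_le i (f := fun i => S (π i) * (groupStep c S γ (π i) ^ 2 *
    groupNoise c F P g ^ 2)) (fun _ => by positivity) (by gcongr)).trans ?_
  simp_rw [← mul_assoc]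
  rw [← Finset.sum_mul]
  gcongr
  exact sum_groupStep_sq_le γ π hM hS hρ

theorem isCentredWithin_roundNoise_self {ρ : ℝ} (hM : 0 < M) (hc : Function.Surjective c)
    (hS : ∀ k, 0 < S k) (hρ : ∀ k, (K : ℝ) * (groupSize c k : ℝ) ≤ ρ * (M : ℝ))
    (hF : ∀ m, IsSmooth L (F m)) (hg : IsStochasticGradient F P g σ) :
    IsCentredWithin (sampleLaw S P) (fun z => roundNoise c g F γ (π, z) x K)
      (γ ^ 2 * ρ / K * groupNoise c F P g ^ 2) := by
  have h1 := isCentredWithin_roundNoise (P := P) (S := S) γ x π hc hF hg le_rfl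
  refine ⟨h1.memLp, h1.mean, h1.sq_le.trans ?_⟩
  rw [before_self]
  simp_rw [← mul_assoc]
  rw [← Finset.sum_mul]
  gcongr
  exact sum_groupStep_sq_le γ π hM hS hρ

end Moments

/-! ### The expected decrease in one round -/

instance (K : ℕ) : DiscreteMeasurableSpace (Equiv.Perm (Fin K)) := ⟨fun _ => trivial⟩

section Smooth

variable {d : ℕ} {L : ℝ≥0} {Ω : Type*} [MeasurableSpace Ω] {μ : Measure Ω} [IsFiniteMeasure μ]
  {f : Param d → ℝ} {X : Ω → Param d}

/-- A smooth function grows at most quadratically. -/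
theorem IsSmooth.integrable_comp (hf : IsSmooth L f) (hX : Measurable X) (x : Param d)
    (h : Integrable (fun a => ‖X a - x‖ ^ 2) μ) : Integrable (fun a => f (X a)) μ := by
  refine Integrable.mono' (g := fun a => (|f x| + ‖gradient f x‖ ^ 2) + (L + 1) * ‖X a - x‖ ^ 2)
    ((integrable_const _).add (h.const_mul _))
    (hf.1.continuous.measurable.comp hX).aestronglyMeasurable
    (Filter.Eventually.of_forall fun a => ?_)
  have h1 := abs_le.1 (abs_sub_sub_inner_gradient_le hf x (X a))
  have h2 := abs_le.1 (abs_real_inner_le_norm (gradient f x) (X a - x))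
  have h3 := abs_le.1 (le_refl |f x|)
  rw [Real.norm_eq_abs, abs_le]
  constructor <;>
    nlinarith [sq_nonneg (‖gradient f x‖ - ‖X a - x‖), sq_nonneg (‖gradient f x‖),
      sq_nonneg ‖X a - x‖]

theorem IsSmooth.norm_gradient_sq_le (hf : IsSmooth L f) (x y : Param d) :
    ‖gradient f y‖ ^ 2 ≤ 2 * ‖gradient f x‖ ^ 2 + 2 * L ^ 2 * ‖y - x‖ ^ 2 := by
  have h1 := hf.2.dist_le_mul y x
  rw [dist_eq_norm, dist_eq_norm] at h1
  have h2 : ‖gradient f y‖ ≤ ‖gradient f x‖ + L * ‖y - x‖ := by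
    have := norm_sub_norm_le (gradient f y) (gradient f x)
    linarith
  have h3 := pow_le_pow_left₀ (norm_nonneg _) h2 2
  nlinarith [sq_nonneg (‖gradient f x‖ - L * ‖y - x‖)]

theorem IsSmooth.integrable_gradient_comp_sq (hf : IsSmooth L f) (hX : Measurable X) (x : Param d)
    (h : Integrable (fun a => ‖X a - x‖ ^ 2) μ) :
    Integrable (fun a => ‖gradient f (X a)‖ ^ 2) μ := by
  refine Integrable.mono' ((integrable_const (2 * ‖gradient f x‖ ^ 2)).add
    (h.const_mul (2 * (L : ℝ) ^ 2)))
    ((hf.measurable_gradient.comp hX).norm.pow_const 2).aestronglyMeasurable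
    (Filter.Eventually.of_forall fun a => ?_)
  rw [Real.norm_of_nonneg (by positivity)]
  exact hf.norm_gradient_sq_le x (X a)

end Smooth

section RoundLaw

variable {M K : ℕ} {Ξ : Type*} [MeasurableSpace Ξ] {S : Fin K → ℕ} {P : Fin M → Measure Ξ}

theorem roundLaw_eq :
    roundLaw S P = (uniformOn (Set.univ : Set (Equiv.Perm (Fin K)))).prod (sampleLaw S P) := rfl

variable [∀ m, IsProbabilityMeasure (P m)]

instance : IsProbabilityMeasure (roundLaw S P) := by
  rw [roundLaw_eq]
  infer_instance

theorem integrable_roundLaw {f : RoundSeed M K S Ξ → ℝ}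
    (hf : ∀ π, Measurable fun z => f (π, z))
    (hint : ∀ π, Integrable (fun z => f (π, z)) (sampleLaw S P)) :
    Integrable f (roundLaw S P) := by
  have hm : Measurable f := measurable_from_prod_countable_right hf
  rw [roundLaw_eq, integrable_prod_iff hm.aestronglyMeasurable]
  exact ⟨Filter.Eventually.of_forall hint, Integrable.of_finite⟩

theorem integral_roundLaw_le {f : RoundSeed M K S Ξ → ℝ}
    (hf : ∀ π, Measurable fun z => f (π, z))
    (hint : ∀ π, Integrable (fun z => f (π, z)) (sampleLaw S P)) {a b : ℝ}
    {e : Equiv.Perm (Fin K) → ℝ} (hle : ∀ π, ∫ z, f (π, z) ∂(sampleLaw S P) ≤ a + e π)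
    (he : ∑ π, e π ≤ Fintype.card (Equiv.Perm (Fin K)) * b) :
    ∫ w, f w ∂(roundLaw S P) ≤ a + b := by
  have hint' := integrable_roundLaw hf hint
  rw [roundLaw_eq] at hint' ⊢
  have hcard : (0 : ℝ) < Fintype.card (Equiv.Perm (Fin K)) := by
    exact_mod_cast Fintype.card_pos
  have hw : ∀ π : Equiv.Perm (Fin K),
      (uniformOn (Set.univ : Set (Equiv.Perm (Fin K)))).real {π} =
        1 / Fintype.card (Equiv.Perm (Fin K)) := by
    intro π
    rw [measureReal_def, uniformOn_univ, Measure.count_singleton]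
    simp
  rw [integral_prod _ hint', integral_fintype Integrable.of_finite]
  simp_rw [hw, smul_eq_mul]
  rw [← Finset.mul_sum]
  calc 1 / (Fintype.card (Equiv.Perm (Fin K)) : ℝ) * ∑ π, ∫ z, f (π, z) ∂(sampleLaw S P)
      ≤ 1 / (Fintype.card (Equiv.Perm (Fin K)) : ℝ) * ∑ π, (a + e π) := by
        gcongr with π
        exact hle π
    _ = a + 1 / (Fintype.card (Equiv.Perm (Fin K)) : ℝ) * ∑ π, e π := by
        rw [Finset.sum_add_distrib, Finset.sum_const, Finset.card_univ, nsmul_eq_mul, mul_add,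
          ← mul_assoc, one_div_mul_cancel hcard.ne', one_mul]
    _ ≤ a + 1 / (Fintype.card (Equiv.Perm (Fin K)) : ℝ) *
          (Fintype.card (Equiv.Perm (Fin K)) * b) := by gcongr
    _ = a + b := by rw [← mul_assoc, one_div_mul_cancel hcard.ne', one_mul]

end RoundLaw

section Dispersion

variable {d M K : ℕ} {F : Fin M → Param d → ℝ} {c : Fin M → Fin K} {S : Fin K → ℕ} {L : ℝ≥0}
  {ρ β ζ γ : ℝ}

theorem one_le_of_mul_groupSize_le (hM : 0 < M)
    (hρ : ∀ k, (K : ℝ) * (groupSize c k : ℝ) ≤ ρ * (M : ℝ)) : 1 ≤ ρ := by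
  have hK : (K : ℝ) ≠ 0 := by exact_mod_cast (Fin.pos (c ⟨0, hM⟩)).ne'
  rw [← sum_groupWeight hM c]
  refine (Finset.sum_le_sum fun k _ => groupWeight_le hM hρ k).trans_eq ?_
  rw [Finset.sum_const, Finset.card_univ, Fintype.card_fin, nsmul_eq_mul]
  field_simp

theorem sum_norm_groupDeviation_sq_le (hM : 0 < M)
    (hρ : ∀ k, (K : ℝ) * (groupSize c k : ℝ) ≤ ρ * (M : ℝ))
    (hhet : BoundedHeterogeneity (groupLoss c F) (meanLoss F) β ζ) (x : Param d) :
    ∑ k, ‖groupDeviation c F x k‖ ^ 2 ≤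
      ρ ^ 2 / K * (β ^ 2 * ‖gradient (meanLoss F) x‖ ^ 2 + ζ ^ 2) := by
  have hK : (K : ℝ) ≠ 0 := by exact_mod_cast (Fin.pos (c ⟨0, hM⟩)).ne'
  calc ∑ k, ‖groupDeviation c F x k‖ ^ 2
      ≤ ∑ k, (ρ / K) ^ 2 * ‖gradient (groupLoss c F k) x - gradient (meanLoss F) x‖ ^ 2 := by
        refine Finset.sum_le_sum fun k _ => ?_
        rw [groupDeviation, norm_smul, mul_pow, Real.norm_of_nonneg (groupWeight_nonneg c k)]
        have h0 := groupWeight_nonneg c k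
        gcongr
        exact groupWeight_le hM hρ k
    _ = ρ ^ 2 / K * (1 / (K : ℝ) *
          ∑ k, ‖gradient (groupLoss c F k) x - gradient (meanLoss F) x‖ ^ 2) := by
        rw [← Finset.mul_sum]
        field_simp
    _ ≤ _ := by
        gcongr
        exact hhet x

theorem norm_visitDeviation_sq_le (x : Param d) (π : Equiv.Perm (Fin K)) (i : Fin K) {s : ℕ}
    (hs : s ≤ S (π i)) :
    ‖visitDeviation c F x S π i s‖ ^ 2 ≤ ‖∑ l ∈ before K i, groupDeviation c F x (π l)‖ ^ 2 +
      ‖∑ l ∈ before K (i + 1), groupDeviation c F x (π l)‖ ^ 2 := by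
  set u := ∑ l ∈ before K i, groupDeviation c F x (π l) with hu
  set v := ∑ l ∈ before K (i + 1), groupDeviation c F x (π l) with hv
  set q : ℝ := (s : ℝ) / S (π i) with hq
  have hq0 : 0 ≤ q := by positivity
  have hq1 : q ≤ 1 := div_le_one_of_le₀ (by exact_mod_cast hs) (by positivity)
  have h1 : visitDeviation c F x S π i s = (1 - q) • u + q • v := by
    rw [hv, sum_before_succ, ← hu, visitDeviation, ← hu, ← hq, sub_smul, one_smul, smul_add]
    abel
  have h2 : ‖visitDeviation c F x S π i s‖ ≤ (1 - q) * ‖u‖ + q * ‖v‖ := by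
    rw [h1]
    refine (norm_add_le _ _).trans_eq ?_
    rw [norm_smul, norm_smul, Real.norm_of_nonneg (sub_nonneg.2 hq1), Real.norm_of_nonneg hq0]
  have h3 := pow_le_pow_left₀ (norm_nonneg _) h2 2
  nlinarith [mul_nonneg (mul_nonneg hq0 (sub_nonneg.2 hq1)) (sq_nonneg (‖u‖ - ‖v‖)),
    mul_nonneg hq0 (sq_nonneg ‖u‖), mul_nonneg (sub_nonneg.2 hq1) (sq_nonneg ‖v‖)]

/-- The weighted sum over a round of the squared accumulated deviations of the group gradients. -/
noncomputable def dispersion (c : Fin M → Fin K) (F : Fin M → Param d → ℝ) (S : Fin K → ℕ) (γ : ℝ)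
    (x : Param d) (π : Equiv.Perm (Fin K)) : ℝ :=
  ∑ i, ∑ t ∈ Finset.range (S (π i)), groupStep c S γ (π i) * ‖visitDeviation c F x S π i t‖ ^ 2

theorem dispersion_le (hM : 0 < M) (hS : ∀ k, 0 < S k)
    (hρ : ∀ k, (K : ℝ) * (groupSize c k : ℝ) ≤ ρ * (M : ℝ)) (hγ : 0 ≤ γ) (x : Param d)
    (π : Equiv.Perm (Fin K)) :
    dispersion c F S γ x π ≤ ∑ i : Fin K, γ * (ρ / K) *
      (‖∑ l ∈ before K i, groupDeviation c F x (π l)‖ ^ 2 +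
        ‖∑ l ∈ before K (i + 1), groupDeviation c F x (π l)‖ ^ 2) := by
  refine Finset.sum_le_sum fun i _ => ?_
  have h0 := groupStep_nonneg c S hγ (π i)
  have hk : (S (π i) : ℝ) ≠ 0 := by exact_mod_cast (hS _).ne'
  set Q := ‖∑ l ∈ before K i, groupDeviation c F x (π l)‖ ^ 2 +
        ‖∑ l ∈ before K (i + 1), groupDeviation c F x (π l)‖ ^ 2 with hQ
  calc ∑ t ∈ Finset.range (S (π i)), groupStep c S γ (π i) * ‖visitDeviation c F x S π i t‖ ^ 2
      ≤ ∑ _t ∈ Finset.range (S (π i)), groupStep c S γ (π i) * Q := by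
        gcongr with t ht
        exact norm_visitDeviation_sq_le x π i (Finset.mem_range.1 ht).le
    _ = γ * groupWeight c (π i) * Q := by
        rw [Finset.sum_const, Finset.card_range, nsmul_eq_mul, ← mul_assoc, groupStep_mul c hS,
          div_self hk, one_mul]
    _ ≤ _ := by
        gcongr
        exact groupWeight_le hM hρ (π i)

/-- On average over the orders, the accumulated deviation stays of the order of the deviation of a
single group. -/
theorem sum_dispersion_le (hM : 0 < M) (hc : Function.Surjective c) (hS : ∀ k, 0 < S k)
    (hρ : ∀ k, (K : ℝ) * (groupSize c k : ℝ) ≤ ρ * (M : ℝ)) (hγ : 0 ≤ γ)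
    (hF : ∀ m, IsSmooth L (F m))
    (hhet : BoundedHeterogeneity (groupLoss c F) (meanLoss F) β ζ) (x : Param d) :
    ∑ π, dispersion c F S γ x π ≤ Fintype.card (Equiv.Perm (Fin K)) *
      (γ * (2 * ρ ^ 3 / K * (β ^ 2 * ‖gradient (meanLoss F) x‖ ^ 2 + ζ ^ 2))) := by
  have hK : (0 : ℝ) < K := by exact_mod_cast Fin.pos (c ⟨0, hM⟩)
  have hρ1 := one_le_of_mul_groupSize_le hM hρ
  set D := ∑ k, ‖groupDeviation c F x k‖ ^ 2 with hD
  set C : ℝ := (Fintype.card (Equiv.Perm (Fin K)) : ℝ) with hC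
  have hperm : ∀ j, ∑ π : Equiv.Perm (Fin K), ‖∑ l ∈ before K j, groupDeviation c F x (π l)‖ ^ 2 ≤
      C * D := fun j => sum_perm_norm_sq_sum_le (sum_groupDeviation x hM hc hF) (before K j)
  calc ∑ π, dispersion c F S γ x π
      ≤ ∑ π : Equiv.Perm (Fin K), ∑ i : Fin K, γ * (ρ / K) *
      (‖∑ l ∈ before K i, groupDeviation c F x (π l)‖ ^ 2 +
        ‖∑ l ∈ before K (i + 1), groupDeviation c F x (π l)‖ ^ 2) :=
        Finset.sum_le_sum fun π _ => dispersion_le hM hS hρ hγ x π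
    _ = ∑ i : Fin K, γ * (ρ / K) *
      (∑ π : Equiv.Perm (Fin K), ‖∑ l ∈ before K i, groupDeviation c F x (π l)‖ ^ 2 +
        ∑ π : Equiv.Perm (Fin K), ‖∑ l ∈ before K (i + 1), groupDeviation c F x (π l)‖ ^ 2) := by
        rw [Finset.sum_comm]
        refine Finset.sum_congr rfl fun i _ => ?_
        rw [← Finset.mul_sum, Finset.sum_add_distrib]
    _ ≤ ∑ _i : Fin K, γ * (ρ / K) * (C * D + C * D) := by
        gcongr with i
        · exact hperm _
        · exact hperm _
    _ = C * (γ * (2 * ρ * D)) := by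
        rw [Finset.sum_const, Finset.card_univ, Fintype.card_fin, nsmul_eq_mul]
        field_simp
        ring
    _ ≤ C * (γ * (2 * ρ * (ρ ^ 2 / K * (β ^ 2 * ‖gradient (meanLoss F) x‖ ^ 2 + ζ ^ 2)))) := by
        gcongr
        exact sum_norm_groupDeviation_sq_le hM hρ hhet x
    _ = _ := by ring

end Dispersion

section Expectation

variable {d M K : ℕ} {Ξ : Type*} [MeasurableSpace Ξ] {L : ℝ≥0} {F : Fin M → Param d → ℝ}
  {c : Fin M → Fin K} {P : Fin M → Measure Ξ} {g : Fin M → Param d → Ξ → Param d} {σ : ℝ}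
  {S : Fin K → ℕ} {γ ρ β ζ : ℝ}

theorem measurable_roundIterate_seed (hg : IsStochasticGradient F P g σ) (x : Param d)
    (π : Equiv.Perm (Fin K)) :
    Measurable fun z : (k : Fin K) → Fin (S k) → Fin M → Ξ =>
      roundIterate c g S γ (π, z) x K :=
  measurable_roundIterate hg π measurable_id measurable_const K

theorem measurable_roundIterate_prod (hg : IsStochasticGradient F P g σ) :
    Measurable fun p : Param d × RoundSeed M K S Ξ => roundIterate c g S γ p.2 p.1 K := by
  have h : Measurable fun q : Equiv.Perm (Fin K) ×
      (Param d × ((k : Fin K) → Fin (S k) → Fin M → Ξ)) =>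
      roundIterate c g S γ (q.1, q.2.2) q.2.1 K :=
    measurable_from_prod_countable_right fun π =>
      measurable_roundIterate hg π measurable_snd measurable_fst K
  exact h.comp ((measurable_fst.comp measurable_snd).prodMk
    (measurable_fst.prodMk (measurable_snd.comp measurable_snd)))

variable [∀ m, IsProbabilityMeasure (P m)]

/-- The expected perturbation of a round with a given order of the groups. -/
theorem integral_perturbation_le (hM : 0 < M) (hc : Function.Surjective c)
    (hS : ∀ k, 0 < S k) (hρ : ∀ k, (K : ℝ) * (groupSize c k : ℝ) ≤ ρ * (M : ℝ))
    (hF : ∀ m, IsSmooth L (F m)) (hg : IsStochasticGradient F P g σ) (hγ : 0 ≤ γ) (x : Param d)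
    (π : Equiv.Perm (Fin K)) :
    Integrable (fun z => perturbation g γ (π, z) x c F) (sampleLaw S P) ∧
    ∫ z, perturbation g γ (π, z) x c F ∂(sampleLaw S P) ≤
      γ ^ 2 * dispersion c F S γ x π +
        γ * (γ ^ 2 * ‖gradient (meanLoss F) x‖ ^ 2 + γ ^ 2 * ρ / K * groupNoise c F P g ^ 2) := by
  have hN : ∀ i, ∀ t ∈ Finset.range (S (π i)), IsCentredWithin (sampleLaw S P)
      (fun z => visitNoise c g F γ (π, z) x i t) (γ ^ 2 * ρ / K * groupNoise c F P g ^ 2) :=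
    fun i t ht => isCentredWithin_visitNoise γ x π hM hc hS hρ hF hg i (Finset.mem_range.1 ht).le
  have hsq : ∀ i, ∀ t ∈ Finset.range (S (π i)),
      Integrable (fun z => ‖visitNoise c g F γ (π, z) x i t‖ ^ 2) (sampleLaw S P) :=
    fun i t ht => (memLp_two_iff_integrable_sq_norm (hN i t ht).memLp.1).1 (hN i t ht).memLp
  have hterm : ∀ i, ∀ t ∈ Finset.range (S (π i)),
      Integrable (fun z : (k : Fin K) → Fin (S k) → Fin M → Ξ => groupStep c S γ (π i) *
        (γ ^ 2 * ‖visitDeviation c F x S π i t‖ ^ 2 + γ ^ 2 * ‖gradient (meanLoss F) x‖ ^ 2 +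
        ‖visitNoise c g F γ (π, z) x i t‖ ^ 2)) (sampleLaw S P) := fun i t ht =>
    ((integrable_const _).add (hsq i t ht)).const_mul _
  simp only [perturbation]
  refine ⟨integrable_finsetSum _ fun i _ => integrable_finsetSum _ fun t ht => hterm i t ht, ?_⟩
  rw [integral_finsetSum _ fun i _ => integrable_finsetSum _ fun t ht => hterm i t ht]
  set v := γ ^ 2 * ρ / K * groupNoise c F P g ^ 2 with hv
  set G := gradient (meanLoss F) x with hG
  calc _ ≤ ∑ i, ∑ t ∈ Finset.range (S (π i)), groupStep c S γ (π i) *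
          (γ ^ 2 * ‖visitDeviation c F x S π i t‖ ^ 2 + γ ^ 2 * ‖G‖ ^ 2 + v) := by
        refine Finset.sum_le_sum fun i _ => ?_
        rw [integral_finsetSum _ fun t ht => hterm i t ht]
        refine Finset.sum_le_sum fun t ht => ?_
        rw [integral_const_mul, integral_add (integrable_const _) (hsq i t ht), integral_const,
          probReal_univ, one_smul]
        have h0 := groupStep_nonneg c S hγ (π i)
        gcongr
        exact (hN i t ht).sq_le
    _ = γ ^ 2 * dispersion c F S γ x π +
          (∑ i, ∑ _t ∈ Finset.range (S (π i)), groupStep c S γ (π i)) *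
            (γ ^ 2 * ‖G‖ ^ 2 + v) := by
        rw [dispersion, Finset.mul_sum, Finset.sum_mul, ← Finset.sum_add_distrib]
        refine Finset.sum_congr rfl fun i _ => ?_
        rw [Finset.mul_sum, Finset.sum_mul, ← Finset.sum_add_distrib]
        exact Finset.sum_congr rfl fun t _ => by ring
    _ = _ := by rw [sum_sum_groupStep γ hM hS π]

variable (γ ρ β ζ) in
/-- An upper bound on the expected perturbation of a round that starts where the gradient has norm
`a`, for the noise level `s`. -/
noncomputable def perturbationBound (K : ℕ) (s a : ℝ) : ℝ :=
  γ ^ 3 * (2 * ρ ^ 3 / K * (β ^ 2 * a ^ 2 + ζ ^ 2)) + γ * (γ ^ 2 * a ^ 2 + γ ^ 2 * ρ / K * s ^ 2)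

theorem integrable_norm_roundIterate_sub_sq (hM : 0 < M) (hc : Function.Surjective c)
    (hS : ∀ k, 0 < S k) (hρ : ∀ k, (K : ℝ) * (groupSize c k : ℝ) ≤ ρ * (M : ℝ))
    (hF : ∀ m, IsSmooth L (F m)) (hg : IsStochasticGradient F P g σ) (hγ : 0 < γ)
    (hγL : 12 * L * γ ≤ 1) (x : Param d) (π : Equiv.Perm (Fin K)) :
    Integrable (fun z => ‖roundIterate c g S γ (π, z) x K - x‖ ^ 2) (sampleLaw S P) ∧
    ∫ z, ‖roundIterate c g S γ (π, z) x K - x‖ ^ 2 ∂(sampleLaw S P) ≤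
      3 * (γ ^ 2 * ‖gradient (meanLoss F) x‖ ^ 2 + 12 * L ^ 2 * γ *
        (γ * (γ ^ 2 * ‖gradient (meanLoss F) x‖ ^ 2 + γ ^ 2 * ρ / K * groupNoise c F P g ^ 2)) +
        γ ^ 2 * ρ / K * groupNoise c F P g ^ 2) +
      3 * (12 * L ^ 2 * γ * (γ ^ 2 * dispersion c F S γ x π)) := by
  obtain ⟨hpint, hple⟩ := integral_perturbation_le hM hc hS hρ hF hg hγ.le x π
  have hN := isCentredWithin_roundNoise_self (P := P) γ x π hM hc hS hρ hF hg
  have hNsq := (memLp_two_iff_integrable_sq_norm hN.memLp.1).1 hN.memLp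
  have hbound : Integrable (fun z => 3 * (γ ^ 2 * ‖gradient (meanLoss F) x‖ ^ 2 +
      12 * L ^ 2 * γ * perturbation g γ (π, z) x c F + ‖roundNoise c g F γ (π, z) x K‖ ^ 2))
      (sampleLaw S P) :=
    (((integrable_const _).add (hpint.const_mul _)).add hNsq).const_mul 3
  have hle : ∀ z, ‖roundIterate c g S γ (π, z) x K - x‖ ^ 2 ≤ _ := fun z =>
    norm_sq_roundIterate_sub_le g (π, z) x hM hc hS hF hγ hγL
  have hmeas := measurable_roundIterate_seed (c := c) (S := S) (γ := γ) hg x π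
  have hint := hbound.mono' ((hmeas.sub measurable_const).norm.pow_const 2).aestronglyMeasurable
    (Filter.Eventually.of_forall fun z => by
      rw [Real.norm_of_nonneg (by positivity)]
      exact hle z)
  refine ⟨hint, (integral_mono hint hbound hle).trans ?_⟩
  rw [integral_const_mul, integral_add (f := fun z => γ ^ 2 * ‖gradient (meanLoss F) x‖ ^ 2 +
      12 * L ^ 2 * γ * perturbation g γ (π, z) x c F)
      ((integrable_const _).add (hpint.const_mul _)) hNsq,
    integral_add (integrable_const _) (hpint.const_mul _), integral_const, probReal_univ,
    one_smul, integral_const_mul]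
  have h1 : 12 * (L : ℝ) ^ 2 * γ * ∫ z, perturbation g γ (π, z) x c F ∂(sampleLaw S P) ≤
      12 * (L : ℝ) ^ 2 * γ * _ := mul_le_mul_of_nonneg_left hple (by positivity)
  linarith [hN.sq_le]

theorem integral_meanLoss_roundIterate_le (hM : 0 < M) (hc : Function.Surjective c)
    (hS : ∀ k, 0 < S k) (hρ : ∀ k, (K : ℝ) * (groupSize c k : ℝ) ≤ ρ * (M : ℝ))
    (hF : ∀ m, IsSmooth L (F m)) (hg : IsStochasticGradient F P g σ) (hγ : 0 < γ)
    (hγL : 12 * L * γ ≤ 1) (x : Param d) (π : Equiv.Perm (Fin K)) :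
    Integrable (fun z => meanLoss F (roundIterate c g S γ (π, z) x K)) (sampleLaw S P) ∧
    ∫ z, meanLoss F (roundIterate c g S γ (π, z) x K) ∂(sampleLaw S P) ≤
      (meanLoss F x - γ / 2 * ‖gradient (meanLoss F) x‖ ^ 2 + 24 * L ^ 2 *
        (γ * (γ ^ 2 * ‖gradient (meanLoss F) x‖ ^ 2 + γ ^ 2 * ρ / K * groupNoise c F P g ^ 2)) +
        3 * L * (γ ^ 2 * ρ / K * groupNoise c F P g ^ 2)) +
      24 * L ^ 2 * (γ ^ 2 * dispersion c F S γ x π) := by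
  obtain ⟨hpint, hple⟩ := integral_perturbation_le hM hc hS hρ hF hg hγ.le x π
  have hN := isCentredWithin_roundNoise_self (P := P) γ x π hM hc hS hρ hF hg
  have hNsq := (memLp_two_iff_integrable_sq_norm hN.memLp.1).1 hN.memLp
  have hNint := hN.memLp.integrable one_le_two
  have hmeas := measurable_roundIterate_seed (c := c) (S := S) (γ := γ) hg x π
  have hint := (isSmooth_meanLoss hF).integrable_comp hmeas x
    (integrable_norm_roundIterate_sub_sq hM hc hS hρ hF hg hγ hγL x π).1
  have hle : ∀ z, meanLoss F (roundIterate c g S γ (π, z) x K) ≤ _ := fun z =>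
    meanLoss_roundIterate_le g (π, z) x hM hc hS hF hγ hγL
  have hb1 : Integrable (fun z => meanLoss F x - γ / 2 * ‖gradient (meanLoss F) x‖ ^ 2 -
      inner ℝ (gradient (meanLoss F) x) (roundNoise c g F γ (π, z) x K)) (sampleLaw S P) :=
    (integrable_const _).sub (hNint.const_inner _)
  have hb2 := hb1.add (hpint.const_mul (24 * (L : ℝ) ^ 2))
  have hb3 := hb2.add (hNsq.const_mul (3 * (L : ℝ)))
  refine ⟨hint, (integral_mono hint hb3 hle).trans ?_⟩
  rw [integral_add' hb2 (hNsq.const_mul (3 * (L : ℝ))), integral_add' hb1 (hpint.const_mul _),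
    integral_sub (integrable_const _) (hNint.const_inner _), integral_inner hNint, hN.mean,
    inner_zero_right, integral_const_mul, integral_const_mul, integral_const, probReal_univ,
    one_smul]
  have h1 : 24 * (L : ℝ) ^ 2 * ∫ z, perturbation g γ (π, z) x c F ∂(sampleLaw S P) ≤
      24 * (L : ℝ) ^ 2 * _ := mul_le_mul_of_nonneg_left hple (by positivity)
  have h2 : 3 * (L : ℝ) * ∫ z, ‖roundNoise c g F γ (π, z) x K‖ ^ 2 ∂(sampleLaw S P) ≤
      3 * (L : ℝ) * _ := mul_le_mul_of_nonneg_left hN.sq_le (by positivity)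
  linarith

/-- The expected decrease of the loss in one round, and a bound on the expected movement. -/
theorem integral_roundLaw_roundIterate_le (hM : 0 < M) (hc : Function.Surjective c)
    (hS : ∀ k, 0 < S k) (hρ : ∀ k, (K : ℝ) * (groupSize c k : ℝ) ≤ ρ * (M : ℝ))
    (hF : ∀ m, IsSmooth L (F m)) (hg : IsStochasticGradient F P g σ)
    (hhet : BoundedHeterogeneity (groupLoss c F) (meanLoss F) β ζ) (hγ : 0 < γ)
    (hγL : 12 * L * γ ≤ 1) (x : Param d) :
    (Integrable (fun w => meanLoss F (roundIterate c g S γ w x K)) (roundLaw S P) ∧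
    ∫ w, meanLoss F (roundIterate c g S γ w x K) ∂(roundLaw S P) ≤
      meanLoss F x - γ / 2 * ‖gradient (meanLoss F) x‖ ^ 2 +
        24 * L ^ 2 * perturbationBound γ ρ β ζ K (groupNoise c F P g) ‖gradient (meanLoss F) x‖ +
        3 * L * (γ ^ 2 * ρ / K * groupNoise c F P g ^ 2)) ∧
    Integrable (fun w => ‖roundIterate c g S γ w x K - x‖ ^ 2) (roundLaw S P) ∧
    ∫ w, ‖roundIterate c g S γ w x K - x‖ ^ 2 ∂(roundLaw S P) ≤
      3 * (γ ^ 2 * ‖gradient (meanLoss F) x‖ ^ 2 + 12 * L ^ 2 * γ *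
        perturbationBound γ ρ β ζ K (groupNoise c F P g) ‖gradient (meanLoss F) x‖ +
        γ ^ 2 * ρ / K * groupNoise c F P g ^ 2) := by
  have hmeas := fun π => measurable_roundIterate_seed (c := c) (S := S) (γ := γ) hg x π
  have hmeas1 := fun π => (isSmooth_meanLoss hF).1.continuous.measurable.comp (hmeas π)
  have hmeas2 := fun π => ((hmeas π).sub (measurable_const (a := x))).norm.pow_const 2
  have h1 := fun π => integral_meanLoss_roundIterate_le hM hc hS hρ hF hg hγ hγL x π
  have h2 := fun π => integrable_norm_roundIterate_sub_sq hM hc hS hρ hF hg hγ hγL x π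
  have hdisp := sum_dispersion_le hM hc hS hρ hγ.le hF hhet x
  have hsum : ∀ a : ℝ, 0 ≤ a → ∑ π, a * dispersion c F S γ x π ≤
      Fintype.card (Equiv.Perm (Fin K)) *
        (a * (γ * (2 * ρ ^ 3 / K * (β ^ 2 * ‖gradient (meanLoss F) x‖ ^ 2 + ζ ^ 2)))) := by
    intro a ha
    rw [← Finset.mul_sum, mul_left_comm]
    exact mul_le_mul_of_nonneg_left hdisp ha
  refine ⟨⟨integrable_roundLaw hmeas1 fun π => (h1 π).1, ?_⟩,
    integrable_roundLaw hmeas2 fun π => (h2 π).1, ?_⟩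
  · refine (integral_roundLaw_le hmeas1 (fun π => (h1 π).1) (fun π => (h1 π).2)
      ((Finset.sum_congr rfl fun π _ => ?_).trans_le
        (hsum (24 * L ^ 2 * γ ^ 2) (by positivity)))).trans_eq ?_
    · ring
    · rw [perturbationBound]
      ring
  · refine (integral_roundLaw_le hmeas2 (fun π => (h2 π).1) (fun π => (h2 π).2)
      ((Finset.sum_congr rfl fun π _ => ?_).trans_le
        (hsum (36 * L ^ 2 * γ ^ 3) (by positivity)))).trans_eq ?_
    · ring
    · rw [perturbationBound]
      ring

end Expectation

/-! ### Many rounds -/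

section Rounds

variable {d M K : ℕ} {Ξ : Type*} [MeasurableSpace Ξ] {L : ℝ≥0} {F : Fin M → Param d → ℝ}
  {c : Fin M → Fin K} {P : Fin M → Measure Ξ} {g : Fin M → Param d → Ξ → Param d} {σ : ℝ}
  {S : Fin K → ℕ} {γ ρ β ζ : ℝ}

theorem measurable_iterate (hg : IsStochasticGradient F P g σ) (x₀ : Param d) {Ω : Type*}
    [MeasurableSpace Ω] {w : ℕ → Ω → RoundSeed M K S Ξ} {r : ℕ}
    (hw : ∀ i < r, Measurable (w i)) :
    Measurable fun a => iterate c g S γ x₀ (fun i => w i a) r := by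
  induction r with
  | zero => exact measurable_const
  | succ r ih =>
    exact (measurable_roundIterate_prod hg).comp
      ((ih fun i hi => hw i (by omega)).prodMk (hw r (Nat.lt_succ_self r)))

/-- The parameter after `r` rounds is independent of the randomness of the next round. -/
theorem indepFun_iterate (hg : IsStochasticGradient F P g σ) (x₀ : Param d) {Ω : Type*}
    [mΩ : MeasurableSpace Ω] {μ : Measure Ω} {w : ℕ → Ω → RoundSeed M K S Ξ}
    (hw : ∀ i, Measurable (w i)) (hind : iIndepFun w μ) (r : ℕ) :
    (fun a => iterate c g S γ x₀ (fun i => w i a) r) ⟂ᵢ[μ] w r := by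
  have h1 := indep_iSup_of_disjoint (fun i => (hw i).comap_le) hind.iIndep
    (S := {i | i < r}) (T := {r}) (by simp)
  rw [iSup_singleton] at h1
  rw [IndepFun_iff_Indep]
  refine indep_of_indep_of_le_left h1 (Measurable.comap_le ?_)
  refine @measurable_iterate d M K Ξ _ F c P g σ S γ hg x₀ Ω
    (⨆ i ∈ {i | i < r}, MeasurableSpace.comap (w i) inferInstance) w r fun i hi => ?_
  exact Measurable.of_comap_le (le_iSup₂_of_le i hi le_rfl)

variable [∀ m, IsProbabilityMeasure (P m)] {Ω : Type*} [MeasurableSpace Ω] {μ : Measure Ω}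
  [IsProbabilityMeasure μ] {w : ℕ → Ω → RoundSeed M K S Ξ}

/-- A bound on the increase of the expected loss in one round which is due to the noise `s` and the
heterogeneity `ζ`. -/
noncomputable def roundError (L : ℝ≥0) (γ ρ ζ : ℝ) (K : ℕ) (s : ℝ) : ℝ :=
  48 * L ^ 2 * γ ^ 3 * ρ ^ 3 * (s ^ 2 + ζ ^ 2) / K + 3 * L * γ ^ 2 * ρ * s ^ 2 / K

/-- If the step length is small, the part of the perturbation caused by the gradient itself is
absorbed by the decrease. -/
theorem perturbationBound_le_roundError {K : ℕ} {s a : ℝ} (hγ : 0 < γ) (hρ : 1 ≤ ρ)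
    (hγL : 24 * L ^ 2 * γ ^ 2 * (1 + 2 * ρ ^ 3 * β ^ 2 / K) ≤ 1 / 4) :
    24 * L ^ 2 * perturbationBound γ ρ β ζ K s a + 3 * L * (γ ^ 2 * ρ / K * s ^ 2) ≤
      γ / 4 * a ^ 2 + roundError L γ ρ ζ K s := by
  have h1 : γ * a ^ 2 * (24 * L ^ 2 * γ ^ 2 * (1 + 2 * ρ ^ 3 * β ^ 2 / K)) ≤
      γ * a ^ 2 * (1 / 4) := by gcongr
  have hρ3 : ρ ≤ 2 * ρ ^ 3 := by nlinarith [mul_nonneg (sub_nonneg.2 hρ) (sq_nonneg ρ)]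
  have h2 : 24 * L ^ 2 * γ ^ 3 * (ρ * s ^ 2 / K) ≤ 24 * L ^ 2 * γ ^ 3 * (2 * ρ ^ 3 * s ^ 2 / K) := by
    gcongr
  calc 24 * L ^ 2 * perturbationBound γ ρ β ζ K s a + 3 * L * (γ ^ 2 * ρ / K * s ^ 2)
      = γ * a ^ 2 * (24 * L ^ 2 * γ ^ 2 * (1 + 2 * ρ ^ 3 * β ^ 2 / K)) +
        24 * L ^ 2 * γ ^ 3 * (ρ * s ^ 2 / K) + 24 * L ^ 2 * γ ^ 3 * (2 * ρ ^ 3 * ζ ^ 2 / K) +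
        3 * L * γ ^ 2 * ρ * s ^ 2 / K := by
        rw [perturbationBound]
        ring
    _ ≤ γ * a ^ 2 * (1 / 4) + 24 * L ^ 2 * γ ^ 3 * (2 * ρ ^ 3 * s ^ 2 / K) +
        24 * L ^ 2 * γ ^ 3 * (2 * ρ ^ 3 * ζ ^ 2 / K) + 3 * L * γ ^ 2 * ρ * s ^ 2 / K := by
        gcongr
    _ = _ := by
        rw [roundError]
        ring

theorem integrable_norm_iterate_sub_sq (hM : 0 < M) (hc : Function.Surjective c)
    (hS : ∀ k, 0 < S k) (hρ : ∀ k, (K : ℝ) * (groupSize c k : ℝ) ≤ ρ * (M : ℝ))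
    (hF : ∀ m, IsSmooth L (F m)) (hg : IsStochasticGradient F P g σ)
    (hhet : BoundedHeterogeneity (groupLoss c F) (meanLoss F) β ζ) (hγ : 0 < γ)
    (hγL : 12 * L * γ ≤ 1) (hw : ∀ i, Measurable (w i)) (hlaw : ∀ i, μ.map (w i) = roundLaw S P)
    (hind : iIndepFun w μ) (x₀ : Param d) (r : ℕ) :
    Integrable (fun a => ‖iterate c g S γ x₀ (fun i => w i a) r - x₀‖ ^ 2) μ := by
  induction r with
  | zero => simp [iterate]
  | succ r ih =>
    have hΘ := measurable_iterate (c := c) (γ := γ) hg x₀ (r := r) fun i _ => hw i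
    have hG := (isSmooth_meanLoss hF).integrable_gradient_comp_sq hΘ x₀ ih
    have hround := integral_roundLaw_roundIterate_le hM hc hS hρ hF hg hhet hγ hγL
    have hf : StronglyMeasurable fun p : Param d × RoundSeed M K S Ξ =>
        ‖roundIterate c g S γ p.2 p.1 K - p.1‖ ^ 2 :=
      (((measurable_roundIterate_prod hg).sub measurable_fst).norm.pow_const 2).stronglyMeasurable
    have hb : Integrable (fun a => 3 * (γ ^ 2 *
        ‖gradient (meanLoss F) (iterate c g S γ x₀ (fun i => w i a) r)‖ ^ 2 + 12 * L ^ 2 * γ *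
        perturbationBound γ ρ β ζ K (groupNoise c F P g)
          ‖gradient (meanLoss F) (iterate c g S γ x₀ (fun i => w i a) r)‖ +
        γ ^ 2 * ρ / K * groupNoise c F P g ^ 2)) μ := by
      simp only [perturbationBound]
      fun_prop
    have hstep : Integrable (fun a => ‖iterate c g S γ x₀ (fun i => w i a) (r + 1) -
        iterate c g S γ x₀ (fun i => w i a) r‖ ^ 2) μ := by
      refine integrable_comp_of_indepFun (f := fun p : Param d × RoundSeed M K S Ξ =>
        ‖roundIterate c g S γ p.2 p.1 K - p.1‖ ^ 2) hΘ (hw r) (indepFun_iterate hg x₀ hw hind r)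
        (hlaw r) hf (fun x => (hround x).2.1) hb fun a => ?_
      simp only [norm_pow, norm_norm]
      exact (hround _).2.2
    refine ((hstep.add ih).const_mul 2).mono'
      (((measurable_iterate hg x₀ fun i _ => hw i).sub
        measurable_const).norm.pow_const 2).aestronglyMeasurable
      (Filter.Eventually.of_forall fun a => ?_)
    rw [Real.norm_of_nonneg (by positivity)]
    set y := iterate c g S γ x₀ (fun i => w i a) (r + 1)
    set y' := iterate c g S γ x₀ (fun i => w i a) r
    have h1 : ‖y - x₀‖ ≤ ‖y - y'‖ + ‖y' - x₀‖ := norm_sub_le_norm_sub_add_norm_sub _ _ _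
    have h2 := pow_le_pow_left₀ (norm_nonneg _) h1 2
    simp only [Pi.add_apply]
    nlinarith [sq_nonneg (‖y - y'‖ - ‖y' - x₀‖)]

/-- The expected loss decreases in each round up to the error of the round. -/
theorem integral_meanLoss_iterate_succ_le (hM : 0 < M) (hc : Function.Surjective c)
    (hS : ∀ k, 0 < S k) (hρ : ∀ k, (K : ℝ) * (groupSize c k : ℝ) ≤ ρ * (M : ℝ))
    (hF : ∀ m, IsSmooth L (F m)) (hg : IsStochasticGradient F P g σ)
    (hhet : BoundedHeterogeneity (groupLoss c F) (meanLoss F) β ζ) (hγ : 0 < γ)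
    (hγL : 12 * L * γ ≤ 1) (hγL' : 24 * L ^ 2 * γ ^ 2 * (1 + 2 * ρ ^ 3 * β ^ 2 / K) ≤ 1 / 4)
    (hw : ∀ i, Measurable (w i)) (hlaw : ∀ i, μ.map (w i) = roundLaw S P)
    (hind : iIndepFun w μ) (x₀ : Param d) (r : ℕ) :
    ∫ a, meanLoss F (iterate c g S γ x₀ (fun i => w i a) (r + 1)) ∂μ ≤
      ∫ a, meanLoss F (iterate c g S γ x₀ (fun i => w i a) r) ∂μ -
      γ / 4 * ∫ a, ‖gradient (meanLoss F) (iterate c g S γ x₀ (fun i => w i a) r)‖ ^ 2 ∂μ +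
      roundError L γ ρ ζ K (groupNoise c F P g) := by
  have hΘ := fun r => measurable_iterate (c := c) (γ := γ) hg x₀ (r := r) fun i _ => hw i
  have hsq := integrable_norm_iterate_sub_sq hM hc hS hρ hF hg hhet hγ hγL hw hlaw hind x₀
  have hG := (isSmooth_meanLoss hF).integrable_gradient_comp_sq (hΘ r) x₀ (hsq r)
  have hFint := fun r => (isSmooth_meanLoss hF).integrable_comp (hΘ r) x₀ (hsq r)
  have hround := integral_roundLaw_roundIterate_le hM hc hS hρ hF hg hhet hγ hγL
  have hf : StronglyMeasurable fun p : Param d × RoundSeed M K S Ξ =>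
      meanLoss F (roundIterate c g S γ p.2 p.1 K) :=
    ((isSmooth_meanLoss hF).1.continuous.measurable.comp
      (measurable_roundIterate_prod hg)).stronglyMeasurable
  have hstep := integral_comp_of_indepFun (f := fun p : Param d × RoundSeed M K S Ξ =>
    meanLoss F (roundIterate c g S γ p.2 p.1 K)) (hΘ r) (hw r) (indepFun_iterate hg x₀ hw hind r)
    (hlaw r) hf (hFint (r + 1))
  have hinner := integrable_integral_comp_of_indepFun
    (f := fun p : Param d × RoundSeed M K S Ξ =>
    meanLoss F (roundIterate c g S γ p.2 p.1 K)) (hΘ r) (hw r) (indepFun_iterate hg x₀ hw hind r)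
    (hlaw r) hf (hFint (r + 1))
  have hb : Integrable (fun a => meanLoss F (iterate c g S γ x₀ (fun i => w i a) r) -
      γ / 4 * ‖gradient (meanLoss F) (iterate c g S γ x₀ (fun i => w i a) r)‖ ^ 2) μ :=
    (hFint r).sub (hG.const_mul _)
  refine hstep.trans_le ((integral_mono hinner (hb.add (integrable_const
    (roundError L γ ρ ζ K (groupNoise c F P g)))) fun a => ?_).trans_eq ?_)
  · have h1 := (hround (iterate c g S γ x₀ (fun i => w i a) r)).1.2
    have h2 := perturbationBound_le_roundError (ζ := ζ) (s := groupNoise c F P g)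
      (a := ‖gradient (meanLoss F) (iterate c g S γ x₀ (fun i => w i a) r)‖) hγ
      (one_le_of_mul_groupSize_le hM hρ) hγL'
    simp only [Pi.add_apply]
    linarith
  · rw [integral_add' hb (integrable_const _),
      integral_sub (hFint r) (hG.const_mul _), integral_const_mul, integral_const, probReal_univ,
      one_smul]

/-- The convergence rate for a given small step length. -/
theorem convergenceMeasure_iterate_le (hM : 0 < M) (hc : Function.Surjective c)
    (hS : ∀ k, 0 < S k) (hρ : ∀ k, (K : ℝ) * (groupSize c k : ℝ) ≤ ρ * (M : ℝ))
    (hF : ∀ m, IsSmooth L (F m)) (hg : IsStochasticGradient F P g σ)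
    (hhet : BoundedHeterogeneity (groupLoss c F) (meanLoss F) β ζ) (hγ : 0 < γ)
    (hγL : 12 * L * γ ≤ 1) (hγL' : 24 * L ^ 2 * γ ^ 2 * (1 + 2 * ρ ^ 3 * β ^ 2 / K) ≤ 1 / 4)
    (hw : ∀ i, Measurable (w i)) (hlaw : ∀ i, μ.map (w i) = roundLaw S P)
    (hind : iIndepFun w μ) (x₀ : Param d) {Fstar Δ : ℝ} (hstar : ∀ x, Fstar ≤ meanLoss F x)
    (hΔ : meanLoss F x₀ - Fstar ≤ Δ) {R : ℕ} (hR : 0 < R) :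
    convergenceMeasure μ (meanLoss F) (fun r a => iterate c g S γ x₀ (fun i => w i a) r) R ≤
      4 * Δ / (γ * R) + 4 * roundError L γ ρ ζ K (groupNoise c F P g) / γ := by
  set err := roundError L γ ρ ζ K (groupNoise c F P g) with herr
  set E : ℕ → ℝ := fun r => ∫ a, meanLoss F (iterate c g S γ x₀ (fun i => w i a) r) ∂μ with hE
  set A : ℕ → ℝ := fun r =>
    ∫ a, ‖gradient (meanLoss F) (iterate c g S γ x₀ (fun i => w i a) r)‖ ^ 2 ∂μ with hA
  have hsum : ∀ n, γ / 4 * ∑ r ∈ Finset.range n, A r ≤ E 0 - E n + n * err := by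
    intro n
    induction n with
    | zero => simp
    | succ n ih =>
      have := integral_meanLoss_iterate_succ_le hM hc hS hρ hF hg hhet hγ hγL hγL' hw hlaw hind x₀ n
      rw [Finset.sum_range_succ, mul_add]
      push_cast
      change E (n + 1) ≤ E n - γ / 4 * A n + err at this
      linarith
  have hE0 : E 0 = meanLoss F x₀ := by simp [hE, iterate]
  have hER : Fstar ≤ E R := by
    have hint := (isSmooth_meanLoss hF).integrable_comp
      (measurable_iterate (c := c) (γ := γ) hg x₀ (r := R) fun i _ => hw i) x₀
      (integrable_norm_iterate_sub_sq hM hc hS hρ hF hg hhet hγ hγL hw hlaw hind x₀ R)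
    have := integral_mono (integrable_const Fstar) hint fun a => hstar _
    simpa using this
  have hmin : ∀ r ∈ Finset.range R, convergenceMeasure μ (meanLoss F)
      (fun r a => iterate c g S γ x₀ (fun i => w i a) r) R ≤ A r := by
    intro r hr
    rw [Finset.mem_range] at hr
    refine ciInf_le (f := fun r : Fin (R + 1) => A r) ⟨0, ?_⟩ ⟨r, by omega⟩
    rintro _ ⟨q, rfl⟩
    exact integral_nonneg fun _ => by positivity
  have hcard := Finset.card_nsmul_le_sum _ _ _ hmin
  rw [Finset.card_range, nsmul_eq_mul] at hcard
  have hR' : (0 : ℝ) < R := by exact_mod_cast hR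
  have h1 := hsum R
  have h2 : γ / 4 * (R * convergenceMeasure μ (meanLoss F)
      (fun r a => iterate c g S γ x₀ (fun i => w i a) r) R) ≤ Δ + R * err := by
    refine (mul_le_mul_of_nonneg_left hcard (by positivity)).trans (h1.trans ?_)
    linarith
  have h3 : 4 * Δ / (γ * R) + 4 * err / γ = (Δ + R * err) * (4 / (γ * R)) := by
    field_simp
  rw [h3, ← div_le_iff₀ (by positivity)]
  refine le_of_eq_of_le ?_ h2
  field_simp

end Rounds

/-! ### The choice of the step length -/

section StepLength

/-- The inverse step length is the sum of the reciprocals of the upper bounds on `γ` that balance the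
terms of the rate. The absolute value makes it positive for every real noise level `s`. -/
noncomputable def stepLength (C : ℝ) (K R : ℕ) (s b z : ℝ) : ℝ :=
  (C * (1 + b ^ 2 / K) + |s| * Real.sqrt R + ((s ^ 2 + z ^ 2) * R / K) ^ (1 / 3 : ℝ))⁻¹

variable {C : ℝ} {K R : ℕ} {s b z : ℝ}

theorem stepLength_pos (hC : 0 < C) : 0 < stepLength C K R s b z := by
  unfold stepLength
  positivity

theorem stepLength_mul_le (hC : 0 < C) : stepLength C K R s b z * (C * (1 + b ^ 2 / K)) ≤ 1 := by
  unfold stepLength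
  rw [inv_mul_le_one₀ (by positivity), add_assoc]
  exact le_add_of_nonneg_right (by positivity)

theorem stepLength_mul_noise_le (hC : 0 < C) :
    stepLength C K R s b z * (|s| * Real.sqrt R) ≤ 1 := by
  unfold stepLength
  rw [inv_mul_le_one₀ (by positivity), add_right_comm]
  exact le_add_of_nonneg_left (by positivity)

theorem stepLength_mul_drift_le (hC : 0 < C) :
    stepLength C K R s b z * ((s ^ 2 + z ^ 2) * R / K) ^ (1 / 3 : ℝ) ≤ 1 := by
  unfold stepLength
  rw [inv_mul_le_one₀ (by positivity)]
  exact le_add_of_nonneg_left (by positivity)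

theorem rpow_one_third_pow {t : ℝ} (ht : 0 ≤ t) : (t ^ (1 / 3 : ℝ)) ^ 3 = t := by
  rw [← Real.rpow_natCast, ← Real.rpow_mul ht]
  norm_num

theorem drift_div_le (hR : 0 < R) (hs : 0 ≤ s) (hz : 0 ≤ z) :
    ((s ^ 2 + z ^ 2) * R / K) ^ (1 / 3 : ℝ) / R ≤
      (s ^ (2 / 3 : ℝ) + z ^ (2 / 3 : ℝ)) / ((K : ℝ) ^ (1 / 3 : ℝ) * (R : ℝ) ^ (2 / 3 : ℝ)) := by
  have hR' : (0 : ℝ) < R := by exact_mod_cast hR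
  have h1 : (R : ℝ) = (R : ℝ) ^ (1 / 3 : ℝ) * (R : ℝ) ^ (2 / 3 : ℝ) := by
    rw [← Real.rpow_add hR']
    norm_num
  have h2 : ∀ t : ℝ, 0 ≤ t → (t ^ 2) ^ (1 / 3 : ℝ) = t ^ (2 / 3 : ℝ) := by
    intro t ht
    rw [← Real.rpow_natCast, ← Real.rpow_mul ht]
    norm_num
  have h3 : (s ^ 2 + z ^ 2) ^ (1 / 3 : ℝ) ≤ s ^ (2 / 3 : ℝ) + z ^ (2 / 3 : ℝ) := by
    rw [← h2 s hs, ← h2 z hz]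
    exact Real.rpow_add_le_add_rpow (sq_nonneg s) (sq_nonneg z) (by norm_num) (by norm_num)
  rw [Real.div_rpow (by positivity) (by positivity), Real.mul_rpow (by positivity) (by positivity)]
  have h4 : (0 : ℝ) < (R : ℝ) ^ (1 / 3 : ℝ) := by positivity
  calc (s ^ 2 + z ^ 2) ^ (1 / 3 : ℝ) * (R : ℝ) ^ (1 / 3 : ℝ) / (K : ℝ) ^ (1 / 3 : ℝ) / R
      = (s ^ 2 + z ^ 2) ^ (1 / 3 : ℝ) * (R : ℝ) ^ (1 / 3 : ℝ) / (K : ℝ) ^ (1 / 3 : ℝ) /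
          ((R : ℝ) ^ (1 / 3 : ℝ) * (R : ℝ) ^ (2 / 3 : ℝ)) := by rw [← h1]
    _ = (s ^ 2 + z ^ 2) ^ (1 / 3 : ℝ) / ((K : ℝ) ^ (1 / 3 : ℝ) * (R : ℝ) ^ (2 / 3 : ℝ)) := by
        field_simp
    _ ≤ _ := by gcongr

/-- With the step length `stepLength`, the bound for a given step length is the rate. -/
theorem rate_le {L : ℝ≥0} {Δ ρ : ℝ} (hC : 0 < C) (hK : 0 < K) (hR : 0 < R) (hs : 0 ≤ s)
    (hz : 0 ≤ z) (hΔ : 0 ≤ Δ) (hρ : 0 ≤ ρ) :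
    4 * Δ / (stepLength C K R s b z * R) +
        4 * roundError L (stepLength C K R s b z) ρ z K s / stepLength C K R s b z ≤
      (4 * Δ + 12 * L * ρ) * s / (R : ℝ) ^ (1 / 2 : ℝ) +
      ((4 * Δ + 192 * L ^ 2 * ρ ^ 3) * s ^ (2 / 3 : ℝ) +
        (4 * Δ + 192 * L ^ 2 * ρ ^ 3) * z ^ (2 / 3 : ℝ)) /
          ((K : ℝ) ^ (1 / 3 : ℝ) * (R : ℝ) ^ (2 / 3 : ℝ)) +
      4 * Δ * C * (1 + b ^ 2 / K) / R := by
  have hR' : (0 : ℝ) < R := by exact_mod_cast hR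
  have hK' : (1 : ℝ) ≤ K := by exact_mod_cast hK
  have hK0 : (0 : ℝ) < K := by exact_mod_cast hK
  set γ := stepLength C K R s b z with hγdef
  set q := ((s ^ 2 + z ^ 2) * R / K) ^ (1 / 3 : ℝ) with hq
  set W := (s ^ (2 / 3 : ℝ) + z ^ (2 / 3 : ℝ)) / ((K : ℝ) ^ (1 / 3 : ℝ) * (R : ℝ) ^ (2 / 3 : ℝ))
    with hW
  have hγ : 0 < γ := stepLength_pos hC
  have hq0 : 0 ≤ q := by positivity
  have hqW : q / R ≤ W := drift_div_le hR hs hz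
  have hq3 : q ^ 3 = (s ^ 2 + z ^ 2) * R / K := rpow_one_third_pow (by positivity)
  have hγq : γ * q ≤ 1 := stepLength_mul_drift_le hC
  have hsqrt : 0 < Real.sqrt R := Real.sqrt_pos.2 hR'
  have hγs : γ * (s * Real.sqrt R) ≤ 1 := by
    have := stepLength_mul_noise_le (K := K) (R := R) (s := s) (b := b) (z := z) hC
    rwa [abs_of_nonneg hs] at this
  have hinv : 1 / γ = C * (1 + b ^ 2 / K) + s * Real.sqrt R + q := by
    rw [hγdef, stepLength, one_div, inv_inv, abs_of_nonneg hs]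
  -- The optimization error is split by the three summands of `1 / γ`.
  have h1 : 4 * Δ / (γ * R) ≤
      4 * Δ * C * (1 + b ^ 2 / K) / R + 4 * Δ * (s / Real.sqrt R) + 4 * Δ * W := by
    have hsR : Real.sqrt R / R = 1 / Real.sqrt R := by
      rw [div_eq_div_iff hR'.ne' hsqrt.ne', Real.mul_self_sqrt hR'.le, one_mul]
    calc 4 * Δ / (γ * R) = 4 * Δ * (1 / γ) / R := by field_simp
      _ = 4 * Δ * C * (1 + b ^ 2 / K) / R + 4 * Δ * (s * (Real.sqrt R / R)) +
          4 * Δ * (q / R) := by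
          rw [hinv]
          ring
      _ = 4 * Δ * C * (1 + b ^ 2 / K) / R + 4 * Δ * (s / Real.sqrt R) + 4 * Δ * (q / R) := by
          rw [hsR, mul_one_div]
      _ ≤ _ := by gcongr
  have h2 : γ * s ^ 2 / K ≤ s / Real.sqrt R := by
    refine (div_le_self (by positivity) hK').trans ?_
    rw [le_div_iff₀ hsqrt]
    calc γ * s ^ 2 * Real.sqrt R = s * (γ * (s * Real.sqrt R)) := by ring
      _ ≤ s * 1 := by gcongr
      _ = s := mul_one s
  have h3 : γ ^ 2 * (s ^ 2 + z ^ 2) / K ≤ W := by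
    calc γ ^ 2 * (s ^ 2 + z ^ 2) / K = (γ * q) ^ 2 * (q / R) := by
          have : (γ * q) ^ 2 * (q / R) = γ ^ 2 * q ^ 3 / R := by ring
          rw [this, hq3]
          field_simp
      _ ≤ 1 ^ 2 * (q / R) := by gcongr
      _ ≤ W := by rwa [one_pow, one_mul]
  have h4 : 4 * roundError L γ ρ z K s / γ =
      192 * L ^ 2 * ρ ^ 3 * (γ ^ 2 * (s ^ 2 + z ^ 2) / K) + 12 * L * ρ * (γ * s ^ 2 / K) := by
    rw [roundError]
    field_simp
    ring
  have h5 : 192 * (L : ℝ) ^ 2 * ρ ^ 3 * (γ ^ 2 * (s ^ 2 + z ^ 2) / K) ≤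
      192 * (L : ℝ) ^ 2 * ρ ^ 3 * W := by gcongr
  have h6 : 12 * (L : ℝ) * ρ * (γ * s ^ 2 / K) ≤ 12 * (L : ℝ) * ρ * (s / Real.sqrt R) := by gcongr
  rw [h4, ← mul_add, mul_div_assoc (4 * Δ + 192 * (L : ℝ) ^ 2 * ρ ^ 3), ← hW, mul_div_assoc _ s,
    ← Real.sqrt_eq_rpow]
  linarith

/-- The conditions under which the loss decreases hold for a large enough constant `C`. -/
theorem stepLength_small {L : ℝ≥0} {ρ : ℝ} (hρ : 1 ≤ ρ) (hC : C = 14 * (L + 1) * ρ ^ 2) :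
    12 * L * stepLength C K R s b z ≤ 1 ∧
    24 * L ^ 2 * stepLength C K R s b z ^ 2 * (1 + 2 * ρ ^ 3 * b ^ 2 / K) ≤ 1 / 4 := by
  have hL0 : (0 : ℝ) ≤ L := L.2
  have hC0 : 0 < C := by rw [hC]; positivity
  set γ := stepLength C K R s b z
  have hγ : 0 < γ := stepLength_pos hC0
  set t : ℝ := b ^ 2 / K with ht
  have ht0 : 0 ≤ t := by positivity
  have h1 : γ * (C * (1 + t)) ≤ 1 := stepLength_mul_le hC0
  have hρ2 : 1 ≤ ρ ^ 2 := one_le_pow₀ hρ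
  have hLC : 14 * L * ρ ^ 2 ≤ C := by
    rw [hC]
    nlinarith
  have h2 : γ * (14 * L * ρ ^ 2 * (1 + t)) ≤ 1 := by
    refine le_trans ?_ h1
    gcongr
  have h3 : 12 * L * γ ≤ γ * (14 * L * ρ ^ 2 * (1 + t)) := by
    have h4 : 12 * (L : ℝ) * 1 ≤ 14 * L * (ρ ^ 2 * (1 + t)) := by
      gcongr
      · norm_num
      · nlinarith
    nlinarith
  refine ⟨h3.trans h2, ?_⟩
  have h5 : (γ * (14 * L * ρ ^ 2 * (1 + t))) ^ 2 ≤ 1 := pow_le_one₀ (by positivity) h2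
  have h6 : 1 + 2 * ρ ^ 3 * t ≤ 2 * (ρ ^ 2 * (1 + t)) ^ 2 := by
    have h7 : ρ ^ 3 ≤ ρ ^ 4 := pow_le_pow_right₀ hρ (by norm_num)
    have h8 : 1 ≤ ρ ^ 4 := one_le_pow₀ hρ
    have h9 : ρ ^ 3 * t ≤ ρ ^ 4 * t := by gcongr
    have h10 : 0 ≤ ρ ^ 4 * t := by positivity
    have h11 : 0 ≤ ρ ^ 4 * t ^ 2 := by positivity
    calc 1 + 2 * ρ ^ 3 * t ≤ 2 * (ρ ^ 4 + 2 * (ρ ^ 4 * t) + ρ ^ 4 * t ^ 2) := by linarith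
      _ = _ := by ring
  have h12 : 2 * ρ ^ 3 * b ^ 2 / K = 2 * ρ ^ 3 * t := by rw [ht]; ring
  rw [h12]
  calc 24 * L ^ 2 * γ ^ 2 * (1 + 2 * ρ ^ 3 * t)
      ≤ 24 * L ^ 2 * γ ^ 2 * (2 * (ρ ^ 2 * (1 + t)) ^ 2) := by gcongr
    _ = 48 / 196 * (γ * (14 * L * ρ ^ 2 * (1 + t))) ^ 2 := by ring
    _ ≤ 48 / 196 * 1 := by gcongr
    _ ≤ 1 / 4 := by norm_num

end StepLength

end GST

theorem theorem1 (L : ℝ≥0) (Δ ρ : ℝ) :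
    -- the constants, and the rule that sets the step length `γ K R σ_g β_g ζ_g`
    ∃ A B C D : ℝ, 0 < A ∧ 0 < B ∧ 0 < C ∧ 0 < D ∧
    ∃ γ : ℕ → ℕ → ℝ → ℝ → ℝ → ℝ, (∀ K R s b z, 0 < γ K R s b z) ∧
    -- the datasets, their partition into `K` nonempty groups, and the number of steps per group
    ∀ (d M K : ℕ) (_ : 0 < M) (c : Fin M → Fin K) (_ : Function.Surjective c)
      (_ : ∀ k, (K : ℝ) * (GST.groupSize c k : ℝ) ≤ ρ * (M : ℝ))
      (S : Fin K → ℕ) (_ : ∀ k, 0 < S k)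
      -- the losses and their stochastic gradients, under the three assumptions
      (F : Fin M → GST.Param d → ℝ) (_ : ∀ m, GST.IsSmooth L (F m))
      (Ξ : Type*) (_ : MeasurableSpace Ξ) (P : Fin M → Measure Ξ)
      (_ : ∀ m, IsProbabilityMeasure (P m))
      (g : Fin M → GST.Param d → Ξ → GST.Param d) (σ : ℝ)
      (_ : GST.IsStochasticGradient F P g σ)
      (β ζ : ℝ) (_ : GST.BoundedHeterogeneity F (GST.meanLoss F) β ζ)
      -- the starting point
      (x₀ : GST.Param d) (Fstar : ℝ) (_ : ∀ x, Fstar ≤ GST.meanLoss F x)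
      (_ : GST.meanLoss F x₀ - Fstar ≤ Δ),
      -- the noise within the groups
      (∀ k x, GST.groupVariance c F P g k x ≤ σ ^ 2 / (GST.groupSize c k : ℝ)) ∧
      -- the heterogeneity between the groups
      GST.BoundedHeterogeneity (GST.groupLoss c F) (GST.meanLoss F)
        (Real.sqrt ((M : ℝ) / ((K : ℝ) * (GST.minGroupSize c : ℝ))) * β)
        (Real.sqrt ((M : ℝ) / ((K : ℝ) * (GST.minGroupSize c : ℝ))) * ζ) ∧
      -- the convergence rate
      ∀ (βg ζg : ℝ) (_ : 0 ≤ βg) (_ : 0 ≤ ζg)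
        (_ : GST.BoundedHeterogeneity (GST.groupLoss c F) (GST.meanLoss F) βg ζg)
        (R : ℕ) (_ : 0 < R)
        (Ω : Type*) (_ : MeasurableSpace Ω) (μ : Measure Ω) (_ : IsProbabilityMeasure μ)
        (w : ℕ → Ω → GST.RoundSeed M K S Ξ) (_ : ∀ r, HasLaw (w r) (GST.roundLaw S P) μ)
        (_ : iIndepFun w μ),
        let σg := GST.groupNoise c F P g
        let Θ : ℕ → Ω → GST.Param d := fun r a =>
          GST.iterate c g S (γ K R σg βg ζg) x₀ (fun i => w i a) r
        (∀ r, Integrable (fun a => ‖gradient (GST.meanLoss F) (Θ r a)‖ ^ 2) μ) ∧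
        GST.convergenceMeasure μ (GST.meanLoss F) Θ R ≤
          A * σg / (R : ℝ) ^ (1 / 2 : ℝ)
          + (B * σg ^ (2 / 3 : ℝ) + C * ζg ^ (2 / 3 : ℝ))
              / ((K : ℝ) ^ (1 / 3 : ℝ) * (R : ℝ) ^ (2 / 3 : ℝ))
          + D * (1 + βg ^ 2 / (K : ℝ)) / (R : ℝ) := by
  -- The constants have to be positive for all `Δ` and `ρ`, whereas every setting that satisfies the
  -- hypotheses has `0 ≤ Δ` and `1 ≤ ρ`; hence `|Δ|` and `max ρ 1`.
  obtain ⟨r, hr⟩ : ∃ r : ℝ, r = max ρ 1 := ⟨_, rfl⟩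
  have hr1 : 1 ≤ r := hr ▸ le_max_right ρ 1
  have hL0 : (0 : ℝ) ≤ L := L.2
  set C₀ : ℝ := 14 * (L + 1) * r ^ 2 with hC₀
  have hC₀pos : 0 < C₀ := by positivity
  refine ⟨4 * |Δ| + 12 * L * r + 1, 4 * |Δ| + 192 * L ^ 2 * r ^ 3 + 1,
    4 * |Δ| + 192 * L ^ 2 * r ^ 3 + 1, 4 * |Δ| * C₀ + 1, by positivity, by positivity,
    by positivity, by positivity, GST.stepLength C₀, fun K R s b z => GST.stepLength_pos hC₀pos, ?_⟩
  intro d M K hM c hc hρ S hS F hF Ξ _ P _ g σ hg β ζ hhet x₀ Fstar hstar hΔ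
  refine ⟨GST.groupVariance_le hc hF hg, GST.boundedHeterogeneity_groupLoss hM hc hF hhet, ?_⟩
  intro βg ζg hβg hζg hhetg R hR Ω _ μ _ w hlaw hind σg Θ
  have hρr : r = ρ := hr.trans (max_eq_left (GST.one_le_of_mul_groupSize_le hM hρ))
  have hΔ0 : 0 ≤ Δ := (sub_nonneg.2 (hstar x₀)).trans hΔ
  have hK : 0 < K := Fin.pos (c ⟨0, hM⟩)
  have hσg : 0 ≤ σg := GST.groupNoise_nonneg
  obtain ⟨hγL, hγL'⟩ := GST.stepLength_small (K := K) (R := R) (s := σg) (b := βg) (z := ζg)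
    hr1 hC₀
  have hγ : 0 < GST.stepLength C₀ K R σg βg ζg := GST.stepLength_pos hC₀pos
  rw [← hρr] at hρ
  -- The seeds are only almost everywhere measurable; they are replaced by measurable ones.
  set w' : ℕ → Ω → GST.RoundSeed M K S Ξ := fun i => (hlaw i).aemeasurable.mk (w i) with hw'
  have hae : ∀ i, w i =ᵐ[μ] w' i := fun i => (hlaw i).aemeasurable.ae_eq_mk
  have hmeas : ∀ i, Measurable (w' i) := fun i => (hlaw i).aemeasurable.measurable_mk
  have hlaw' : ∀ i, μ.map (w' i) = GST.roundLaw S P := fun i =>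
    (Measure.map_congr (hae i)).symm.trans (hlaw i).map_eq
  have hind' : iIndepFun w' μ := hind.congr hae
  have hΘ : ∀ n, (fun a => ‖gradient (GST.meanLoss F) (Θ n a)‖ ^ 2) =ᵐ[μ] fun a =>
      ‖gradient (GST.meanLoss F) (GST.iterate c g S (GST.stepLength C₀ K R σg βg ζg) x₀
        (fun i => w' i a) n)‖ ^ 2 := by
    intro n
    filter_upwards [ae_all_iff.2 hae] with a ha
    simp only [Θ, ha]
  refine ⟨fun n => ?_, ?_⟩
  · exact ((GST.isSmooth_meanLoss hF).integrable_gradient_comp_sq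
      (GST.measurable_iterate hg x₀ fun i _ => hmeas i) x₀
      (GST.integrable_norm_iterate_sub_sq hM hc hS hρ hF hg hhetg hγ hγL hmeas hlaw' hind' x₀
        n)).congr (hΘ n).symm
  · have hconv : GST.convergenceMeasure μ (GST.meanLoss F) Θ R =
        GST.convergenceMeasure μ (GST.meanLoss F) (fun n a => GST.iterate c g S
          (GST.stepLength C₀ K R σg βg ζg) x₀ (fun i => w' i a) n) R :=
      iInf_congr fun n => integral_congr_ae (hΘ n)
    rw [hconv]
    refine (GST.convergenceMeasure_iterate_le hM hc hS hρ hF hg hhetg hγ hγL hγL' hmeas hlaw'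
      hind' x₀ hstar hΔ hR).trans ((GST.rate_le hC₀pos hK hR hσg hζg hΔ0
      (zero_le_one.trans hr1)).trans ?_)
    rw [abs_of_nonneg hΔ0]
    generalize 4 * Δ + 12 * L * r = A
    generalize 4 * Δ + 192 * L ^ 2 * r ^ 3 = B
    generalize 4 * Δ * C₀ = D
    gcongr
    all_goals linarith
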